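/- Let $0\le k\le N$ be integers. In the real vector space of complex $N\times N$ matrices, let $\mathcal R_k$ be the set of matrices of rank at most $k$, let $\mathcal H$ be the set of Hankel matrices (those $A$ for which $A(j,l)$ depends only on $j+l$), and let $\mathcal H_k=\mathcal R_k\cap\mathcal H$. Manifolds are embedded smooth real submanifolds of the space of matrices. A set $M$ has dimension $d$ if the points near which it is a manifold of dimension $d$ are dense in $M$. A set is thin in such a set $M$ if it is contained in the union of finitely many manifolds of dimension lower than that of $M$. A point $A\in\mathcal H_k$ is non-tangential if each of $\mathcal R_k$, $\mathcal H$ and $\mathcal H_k$ is a manifold near $A$ and $$T_{\mathcal R_k}(A)\cap T_{\mathcal H}(A)=T_{\mathcal R_k\cap\mathcal H}(A);$$ all other points of $\mathcal H_k$ are called tangential. Let $\mathcal H_k^n$ be the set of those $A\in\mathcal H_k$ whose upper left $k\times k$ corner is non-singular and which are of the form $A=(f(j+l))_{0\le j,l\le N-1}$ for some $f:\mathbb N\to\mathbb C$ that satisfies $\sum_{l=0}^{k}\lambda_l f(j+l)=0$ for all $j\ge 0$, with a monic polynomial $P(x)=\sum_{l=0}^k\lambda_l x^l$ of degree $k$ having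 only simple zeros, all different from $0$. Then the set of tangential points is thin in $\mathcal H_k$. Moreover, the points of $\mathcal H_k^n$ that are tangential form a set that is thin in $\mathcal H_k^n$; that is, at generic points of $\mathcal H_k^n$ the intersection of the tangent spaces of $\mathcal R_k$ and $\mathcal H$ equals the tangent space of their intersection. -/

import Mathlib

open Set Filter Topology
open scoped ContDiff

attribute [local instance] Matrix.frobeniusNormedAddCommGroup Matrix.frobeniusNormedSpace

section Manifolds

variable {E : Type*} [NormedAddCommGroup E] [NormedSpace ℝ E]

/-- Near its point `A`, the set `S` is an embedded smooth submanifold of `E` of (real) dimension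
`d`: a smooth change of coordinates `φ` of the ambient space, defined near `A`, carries `S` to
a `d`-dimensional linear subspace `F`. -/
def IsManifoldAt (d : ℕ) (S : Set E) (A : E) : Prop :=
  A ∈ S ∧ ∃ (φ : OpenPartialHomeomorph E E) (F : Submodule ℝ E),
    A ∈ φ.source ∧ ContDiffOn ℝ ∞ φ φ.source ∧ ContDiffOn ℝ ∞ φ.symm φ.target ∧
      Module.finrank ℝ F = d ∧ ∀ X ∈ φ.source, X ∈ S ↔ φ X ∈ F

/-- `S` is an embedded smooth submanifold of `E` of dimension `d`. -/
def IsSmoothSubmanifold (d : ℕ) (S : Set E) : Prop :=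
  ∀ A ∈ S, IsManifoldAt d S A

/-- `M` is of dimension `d`: the points near which `M` is a manifold of dimension `d` are dense
in `M`. -/
def HasManifoldDim (d : ℕ) (M : Set E) : Prop :=
  M ⊆ closure {A | IsManifoldAt d M A}

/-- `T` is thin relatively to `M`: it is contained in the union of finitely many manifolds of
dimension lower than the dimension of `M`. -/
def IsThinIn (T M : Set E) : Prop :=
  ∃ d : ℕ, HasManifoldDim d M ∧
    ∃ (m : ℕ) (S : Fin m → Set E) (e : Fin m → ℕ),
      (∀ i, e i < d ∧ IsSmoothSubmanifold (e i) (S i)) ∧ T ⊆ ⋃ i, S i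

/-- The tangent space of `S` at `A`: the velocities of the curves in `S` through `A`. It is used at
points near which `S` is a manifold. -/
def tangentVectors (S : Set E) (A : E) : Set E :=
  {v | ∃ γ : ℝ → E, γ 0 = A ∧ (∀ᶠ t in 𝓝 (0 : ℝ), γ t ∈ S) ∧ HasDerivAt γ v 0}

/-- `A` is a regular point of `M₁ ∩ M₂`: near `A`, the sets `M₁`, `M₂` and `M₁ ∩ M₂` are manifolds
of constant dimension. -/
def IsRegularPoint (M₁ M₂ : Set E) (A : E) : Prop :=
  (∃ d, IsManifoldAt d M₁ A) ∧ (∃ d, IsManifoldAt d M₂ A) ∧ ∃ d, IsManifoldAt d (M₁ ∩ M₂) A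

/-- `A` is a non-tangential point of `M₁ ∩ M₂`: the three tangent spaces at `A` make sense and the
tangent space of the intersection is the intersection of the tangent spaces. -/
def IsNonTangential (M₁ M₂ : Set E) (A : E) : Prop :=
  IsRegularPoint M₁ M₂ A ∧
    tangentVectors M₁ A ∩ tangentVectors M₂ A = tangentVectors (M₁ ∩ M₂) A

end Manifolds

/-- The complex `N × N` matrices of rank at most `k`. -/
def rankLE (N k : ℕ) : Set (Matrix (Fin N) (Fin N) ℂ) :=
  {A | A.rank ≤ k}

/-- The complex `N × N` Hankel matrices. -/
def hankelMatrices (N : ℕ) : Set (Matrix (Fin N) (Fin N) ℂ) :=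
  {A | ∀ j l j' l' : Fin N, (j : ℕ) + l = (j' : ℕ) + l' → A j l = A j' l'}

/-- The Hankel matrices of rank at most `k`. -/
def hankelRankLE (N k : ℕ) : Set (Matrix (Fin N) (Fin N) ℂ) :=
  rankLE N k ∩ hankelMatrices N

/-- `P` is the central polynomial (of degree `r`) of `A`: `A` extends to an infinite Hankel
matrix `(f (j + l))` where `f` satisfies the linear recursion with characteristic polynomial `P`. -/
def IsCentralPolynomial {N : ℕ} (A : Matrix (Fin N) (Fin N) ℂ) (r : ℕ) (P : Polynomial ℂ) : Prop :=
  P.Monic ∧ P.natDegree = r ∧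
    ∃ f : ℕ → ℂ, (∀ j l : Fin N, A j l = f (j + l)) ∧
      ∀ j : ℕ, ∑ l ∈ Finset.range (r + 1), P.coeff l * f (j + l) = 0

/-- The class of Hankel matrices of rank at most `r` whose upper left corner of order `r` is
non-singular and whose central polynomial has only simple zeros, none of them `0`. -/
def genericHankel (N r : ℕ) : Set (Matrix (Fin N) (Fin N) ℂ) :=
  {A | A ∈ hankelRankLE N r ∧
    (∃ h : r ≤ N, (A.submatrix (Fin.castLE h) (Fin.castLE h)).det ≠ 0) ∧
    ∃ P : Polynomial ℂ, IsCentralPolynomial A r P ∧ P.coeff 0 ≠ 0 ∧ P.roots.Nodup}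

/-- The tangential points of the set of Hankel matrices of rank at most `k`. The points at which
one of the three tangent spaces does not exist are counted among them. -/
def tangentialPoints (N k : ℕ) : Set (Matrix (Fin N) (Fin N) ℂ) :=
  {A | A ∈ hankelRankLE N k ∧ ¬ IsNonTangential (rankLE N k) (hankelMatrices N) A}

/-! The case `k = N` is trivial, since every matrix has rank at most `N`. Let `k < N` and encode a
Hankel matrix by its sequence of `2 * N - 1` antidiagonals. If the leading minor of order `p` is
nonzero, the first `2 * p` terms determine a unique recursion of order `p` and hence a continuation.
`stratum N p s c` requires the terms to follow it, except for the last `s`. The stratum is therefore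
a graph over `2 * p + s` complex coordinates, a manifold of real dimension `2 * (2 * p + s)`
(`isManifoldAt_stratum`).

The strata with `p + s ≤ k` cover the Hankel matrices of rank at most `k` (`exists_mem_stratum`).
The one with `(p, s) = (k, 0)` is relatively open, and it is dense by `hankelRankLE_subset_closure`.
All the others have smaller dimension, so it suffices that no point of the open stratum is
tangential.

At such a point `A` the null vectors include the shifts of the coefficient vector of the
characteristic polynomial `P` of the recursion. A tangent vector of the rank variety pairs to zero
with left and right null vectors (`bilin_eq_zero_of_mem_tangentVectors`). For a Hankel tangent
vector this says that its sequence obeys the recursion with polynomial `P ^ 2`, so that `2 * k`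
initial terms determine it. Any such initial terms are realised by a curve inside the intersection
(`exists_mem_tangentVectors`), so the tangent spaces intersect as required. The generic class is
open in the stratum `(k, 0)` and hence contains no tangential points at all. -/

/-! ### Manifolds straightened by shears -/

section Shear

variable {E : Type*} [NormedAddCommGroup E] [NormedSpace ℝ E]

/-- A set that a shear `X ↦ X - g X` straightens to a linear subspace is a manifold. -/
theorem isManifoldAt_of_shear {S U : Set E} {A : E} (F : Submodule ℝ E) (g : E → E)
    (hU : IsOpen U) (hg : ContDiffOn ℝ ∞ g U)
    (hsub : ∀ X ∈ U, X - g X ∈ U ∧ g (X - g X) = g X)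
    (hadd : ∀ X ∈ U, X + g X ∈ U ∧ g (X + g X) = g X)
    (hA : A ∈ U) (hAS : A ∈ S) (hS : ∀ X ∈ U, X ∈ S ↔ X - g X ∈ F) :
    IsManifoldAt (Module.finrank ℝ F) S A := by
  let φ : OpenPartialHomeomorph E E :=
    { toFun := fun X => X - g X
      invFun := fun X => X + g X
      source := U
      target := U
      map_source' := fun X hX => (hsub X hX).1
      map_target' := fun X hX => (hadd X hX).1
      left_inv' := fun X hX => by simp [(hsub X hX).2]
      right_inv' := fun X hX => by simp [(hadd X hX).2]
      open_source := hU
      open_target := hU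
      continuousOn_toFun := continuousOn_id.sub hg.continuousOn
      continuousOn_invFun := continuousOn_id.add hg.continuousOn }
  exact ⟨hAS, φ, F, hA, contDiffOn_id.sub hg, contDiffOn_id.add hg, rfl, hS⟩

theorem isManifoldAt_submodule (F : Submodule ℝ E) {A : E} (hA : A ∈ F) :
    IsManifoldAt (Module.finrank ℝ F) (F : Set E) A :=
  isManifoldAt_of_shear (U := univ) F (fun _ => 0) isOpen_univ contDiffOn_const (by simp)
    (by simp) (mem_univ _) hA (by simp)

theorem IsManifoldAt.congr {d : ℕ} {S S' : Set E} {A : E} (h : IsManifoldAt d S A)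
    (hS : ∀ᶠ X in 𝓝 A, X ∈ S ↔ X ∈ S') : IsManifoldAt d S' A := by
  obtain ⟨hA, φ, F, hAs, h1, h2, h3, h4⟩ := h
  obtain ⟨V, hV, hVo, hAV⟩ := eventually_nhds_iff.1 hS
  refine ⟨(hS.self_of_nhds).1 hA, φ.restrOpen V hVo, F, ⟨hAs, hAV⟩, h1.mono fun X hX => hX.1,
    h2.mono fun X hX => hX.1, h3, ?_⟩
  rintro X ⟨hX, hXV⟩
  rw [← hV X hXV]
  exact h4 X hX

theorem isThinIn_of_finite {ι : Type*} [Finite ι] {T M : Set E} {d : ℕ} (hM : HasManifoldDim d M)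
    (S : ι → Set E) (e : ι → ℕ) (hS : ∀ i, e i < d ∧ IsSmoothSubmanifold (e i) (S i))
    (hT : T ⊆ ⋃ i, S i) : IsThinIn T M := by
  obtain ⟨m, ⟨σ⟩⟩ := Finite.exists_equiv_fin ι
  refine ⟨d, hM, m, S ∘ σ.symm, e ∘ σ.symm, fun i => hS _, fun X hX => ?_⟩
  obtain ⟨i, hi⟩ := mem_iUnion.1 (hT hX)
  exact mem_iUnion.2 ⟨σ i, by simpa using hi⟩

end Shear

/-! ### Smoothness of determinants, inverses and matrix-valued maps -/

section Smoothness

variable {V : Type*} [NormedAddCommGroup V] [NormedSpace ℝ V] {s : Set V}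

theorem contDiffOn_det {n : Type*} [Fintype n] [DecidableEq n] {M : V → Matrix n n ℂ}
    (h : ∀ i j, ContDiffOn ℝ ∞ (fun x => M x i j) s) :
    ContDiffOn ℝ ∞ (fun x => (M x).det) s := by
  simp only [Matrix.det_apply, Units.smul_def, zsmul_eq_mul]
  exact ContDiffOn.sum fun σ _ => contDiffOn_const.mul (contDiffOn_prod fun i _ => h _ _)

theorem contDiffOn_inv_apply {n : Type*} [Fintype n] [DecidableEq n] {M : V → Matrix n n ℂ}
    (h : ∀ i j, ContDiffOn ℝ ∞ (fun x => M x i j) s) (h0 : ∀ x ∈ s, (M x).det ≠ 0) (i j : n) :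
    ContDiffOn ℝ ∞ (fun x => (M x)⁻¹ i j) s := by
  simp only [Matrix.inv_def, Ring.inverse_eq_inv', Matrix.smul_apply, smul_eq_mul,
    Matrix.adjugate_apply]
  refine ((contDiffOn_det h).inv h0).mul (contDiffOn_det fun a b => ?_)
  by_cases ha : a = j
  · subst ha
    simpa using contDiffOn_const
  · simpa [Matrix.updateRow_ne ha] using h a b

variable {N : ℕ}

/-- The entry at position `(i, j)`, as a continuous real linear map. -/
noncomputable def entryCLM (i j : Fin N) : Matrix (Fin N) (Fin N) ℂ →L[ℝ] ℂ :=
  LinearMap.toContinuousLinearMap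
    { toFun := fun X => X i j, map_add' := fun _ _ => rfl, map_smul' := fun _ _ => rfl }

@[simp] theorem entryCLM_apply (i j : Fin N) (X : Matrix (Fin N) (Fin N) ℂ) :
    entryCLM i j X = X i j := rfl

theorem contDiff_entry (i j : Fin N) :
    ContDiff ℝ ∞ fun X : Matrix (Fin N) (Fin N) ℂ => X i j :=
  (entryCLM i j).contDiff

theorem matrix_eq_sum_smul (X : Matrix (Fin N) (Fin N) ℂ) :
    X = ∑ i, ∑ j, (ContinuousLinearMap.toSpanSingleton ℂ (Matrix.single i j (1 : ℂ))) (X i j) := by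
  conv_lhs => rw [Matrix.matrix_eq_sum_single X]
  simp

theorem contDiffOn_matrix {f : V → Matrix (Fin N) (Fin N) ℂ}
    (h : ∀ i j, ContDiffOn ℝ ∞ (fun x => f x i j) s) : ContDiffOn ℝ ∞ f s := by
  have : f = fun x => ∑ i, ∑ j,
      (ContinuousLinearMap.toSpanSingleton ℂ (Matrix.single i j (1 : ℂ))) (f x i j) :=
    funext fun x => matrix_eq_sum_smul (f x)
  rw [this]
  exact ContDiffOn.sum fun i _ => ContDiffOn.sum fun j _ =>
    ((ContinuousLinearMap.toSpanSingleton ℂ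
      (Matrix.single i j (1 : ℂ))).restrictScalars ℝ).contDiff.comp_contDiffOn (h i j)

theorem tendsto_matrix {Y : Type*} {l : Filter Y} {f : Y → Matrix (Fin N) (Fin N) ℂ}
    {A : Matrix (Fin N) (Fin N) ℂ} (h : ∀ i j, Tendsto (fun x => f x i j) l (𝓝 (A i j))) :
    Tendsto f l (𝓝 A) := by
  rw [funext fun x => matrix_eq_sum_smul (f x), matrix_eq_sum_smul A]
  exact tendsto_finsetSum _ fun i _ => tendsto_finsetSum _ fun j _ =>
    ((ContinuousLinearMap.continuous _).tendsto _).comp (h i j)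

end Smoothness

/-! ### Hankel matrices as sequences -/

section HankelSequences

variable {N : ℕ}

/-- The sequence of the values of `X` on its antidiagonals, continued by the constant `c`. -/
def hankelSeq (c : ℂ) (X : Matrix (Fin N) (Fin N) ℂ) (m : ℕ) : ℂ :=
  if h : m + 1 < 2 * N then X ⟨min m (N - 1), by omega⟩ ⟨m - (N - 1), by omega⟩ else c

/-- The Hankel matrix `(a (i + j))`. -/
def hankelOf {R : Type*} (N : ℕ) (a : ℕ → R) : Matrix (Fin N) (Fin N) R :=
  Matrix.of fun i j => a (i + j)

@[simp] theorem hankelOf_apply {R : Type*} (a : ℕ → R) (i j : Fin N) :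
    hankelOf N a i j = a (i + j) := rfl

theorem hankelOf_congr {R : Type*} {k : ℕ} {a b : ℕ → R} (h : ∀ m < 2 * k, a m = b m) :
    hankelOf k a = hankelOf k b := by
  ext i j
  exact h _ (by omega)

theorem hankelOf_mem (a : ℕ → ℂ) : hankelOf N a ∈ hankelMatrices N := by
  intro j l j' l' h
  simp [h]

theorem hankelSeq_hankelOf (c : ℂ) (a : ℕ → ℂ) {m : ℕ} (hm : m + 1 < 2 * N) :
    hankelSeq c (hankelOf N a) m = a m := by
  rw [hankelSeq, dif_pos hm, hankelOf_apply]
  congr 1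
  simp only
  omega

theorem hankelSeq_of_le (c : ℂ) (X : Matrix (Fin N) (Fin N) ℂ) {m : ℕ} (hm : 2 * N ≤ m + 1) :
    hankelSeq c X m = c := dif_neg (by omega)

theorem apply_eq_hankelSeq (c : ℂ) {X : Matrix (Fin N) (Fin N) ℂ} (hX : X ∈ hankelMatrices N)
    (i j : Fin N) : X i j = hankelSeq c X (i + j) := by
  have h : (i : ℕ) + j + 1 < 2 * N := by omega
  rw [hankelSeq, dif_pos h]
  apply hX
  simp only
  omega

theorem hankelOf_hankelSeq (c : ℂ) {X : Matrix (Fin N) (Fin N) ℂ} (hX : X ∈ hankelMatrices N) :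
    hankelOf N (hankelSeq c X) = X := by
  ext i j
  rw [hankelOf_apply, apply_eq_hankelSeq c hX]

theorem hankelSeq_sub (c : ℂ) (X Y : Matrix (Fin N) (Fin N) ℂ) {m : ℕ} (hm : m + 1 < 2 * N) :
    hankelSeq c (X - Y) m = hankelSeq c X m - hankelSeq c Y m := by
  simp [hankelSeq, dif_pos hm]

theorem hankelSeq_add (c : ℂ) (X Y : Matrix (Fin N) (Fin N) ℂ) {m : ℕ} (hm : m + 1 < 2 * N) :
    hankelSeq c (X + Y) m = hankelSeq c X m + hankelSeq c Y m := by
  simp [hankelSeq, dif_pos hm]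

theorem contDiff_hankelSeq (c : ℂ) (m : ℕ) :
    ContDiff ℝ ∞ fun X : Matrix (Fin N) (Fin N) ℂ => hankelSeq c X m := by
  by_cases hm : m + 1 < 2 * N
  · simpa only [hankelSeq, dif_pos hm] using contDiff_entry _ _
  · simpa only [hankelSeq, dif_neg hm] using contDiff_const

/-- The Hankel matrices form a linear subspace. -/
def hankelSubmodule (N : ℕ) : Submodule ℝ (Matrix (Fin N) (Fin N) ℂ) where
  carrier := hankelMatrices N
  add_mem' {A B} hA hB i j i' j' h := by simp [hA i j i' j' h, hB i j i' j' h]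
  zero_mem' i j i' j' _ := by simp
  smul_mem' r A hA i j i' j' h := by simp [hA i j i' j' h]

/-- The embedding of the Hankel matrices whose antidiagonals vanish outside `s`. -/
noncomputable def hankelCoord (N : ℕ) (s : Finset ℕ) : (s → ℂ) →ₗ[ℝ] Matrix (Fin N) (Fin N) ℂ where
  toFun v := hankelOf N fun m => if h : m ∈ s then v ⟨m, h⟩ else 0
  map_add' v w := by
    ext i j
    by_cases h : (i : ℕ) + j ∈ s <;> simp [h]
  map_smul' r v := by
    ext i j
    by_cases h : (i : ℕ) + j ∈ s <;> simp [h]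

theorem hankelCoord_apply (s : Finset ℕ) (v : s → ℂ) :
    hankelCoord N s v = hankelOf N fun m => if h : m ∈ s then v ⟨m, h⟩ else 0 := rfl

theorem mem_range_hankelCoord {s : Finset ℕ} {X : Matrix (Fin N) (Fin N) ℂ} (c : ℂ) :
    X ∈ LinearMap.range (hankelCoord N s) ↔
      X ∈ hankelMatrices N ∧ ∀ m, m + 1 < 2 * N → m ∉ s → hankelSeq c X m = 0 := by
  constructor
  · rintro ⟨v, rfl⟩
    rw [hankelCoord_apply]
    refine ⟨hankelOf_mem _, fun m hm hms => ?_⟩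
    rw [hankelSeq_hankelOf c _ hm, dif_neg hms]
  · rintro ⟨hX, h⟩
    refine ⟨fun m => hankelSeq c X m, ?_⟩
    ext i j
    rw [hankelCoord_apply, hankelOf_apply, apply_eq_hankelSeq c hX i j]
    split_ifs with hs
    · rfl
    · exact (h _ (by omega) hs).symm

theorem finrank_range_hankelCoord {s : Finset ℕ} (hs : ∀ m ∈ s, m + 1 < 2 * N) :
    Module.finrank ℝ (LinearMap.range (hankelCoord N s)) = 2 * s.card := by
  rw [LinearMap.finrank_range_of_inj]
  · rw [Module.finrank_pi_fintype]
    simp [Complex.finrank_real_complex, mul_comm]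
  · intro v w h
    ext ⟨m, hm⟩
    have h1 := congrArg (fun X => hankelSeq 0 X m) h
    simp only [hankelCoord_apply] at h1
    rw [hankelSeq_hankelOf _ _ (hs m hm), hankelSeq_hankelOf _ _ (hs m hm)] at h1
    simpa [hm] using h1

end HankelSequences

/-! ### Linear recursions and the continuation of a sequence -/

section Recursions

variable {R : Type*} [CommRing R] {k : ℕ}

/-- The sequence with the initial values `a 0, …, a (k - 1)` that satisfies the linear recursion
with characteristic polynomial `x ^ k + ∑ l, q l * x ^ l`. -/
def recExt (q : Fin k → R) (a : ℕ → R) (m : ℕ) : R :=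
  if m < k then a m else -∑ l : Fin k, q l * recExt q a (m - k + l)
termination_by m
decreasing_by omega

theorem recExt_of_lt (q : Fin k → R) (a : ℕ → R) {m : ℕ} (hm : m < k) : recExt q a m = a m := by
  rw [recExt, if_pos hm]

theorem recExt_add (q : Fin k → R) (a : ℕ → R) (m : ℕ) :
    recExt q a (m + k) + ∑ l : Fin k, q l * recExt q a (m + l) = 0 := by
  rw [recExt, if_neg (by omega)]
  simp

theorem recExt_eq_of_rec {q : Fin k → R} {a : ℕ → R} {M : ℕ}
    (h : ∀ j, j + k < M → a (j + k) + ∑ l : Fin k, q l * a (j + l) = 0) {m : ℕ} (hm : m < M) :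
    recExt q a m = a m := by
  induction m using Nat.strong_induction_on with
  | _ m ih =>
    by_cases hmk : m < k
    · exact recExt_of_lt q a hmk
    · obtain ⟨j, rfl⟩ : ∃ j, m = j + k := ⟨m - k, by omega⟩
      rw [eq_neg_of_add_eq_zero_left (recExt_add q a j), eq_neg_of_add_eq_zero_left (h j hm)]
      congr 1
      exact Finset.sum_congr rfl fun l _ => by rw [ih _ (by omega) (by omega)]

theorem recExt_congr {q : Fin k → R} {a b : ℕ → R} (h : ∀ m < k, a m = b m) :
    recExt q a = recExt q b := by
  funext m
  induction m using Nat.strong_induction_on with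
  | _ m ih =>
    by_cases hmk : m < k
    · rw [recExt_of_lt q a hmk, recExt_of_lt q b hmk, h m hmk]
    · obtain ⟨j, rfl⟩ : ∃ j, m = j + k := ⟨m - k, by omega⟩
      rw [eq_neg_of_add_eq_zero_left (recExt_add q a j),
        eq_neg_of_add_eq_zero_left (recExt_add q b j)]
      congr 1
      exact Finset.sum_congr rfl fun l _ => by rw [ih _ (by omega)]

/-- Needed for evaluation of polynomials: a family of sequences depending polynomially on a
parameter is a single sequence over the polynomial ring. -/
theorem map_recExt {S : Type*} [CommRing S] (f : R →+* S) (q : Fin k → R) (a : ℕ → R) (m : ℕ) :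
    f (recExt q a m) = recExt (fun l => f (q l)) (fun i => f (a i)) m := by
  induction m using Nat.strong_induction_on with
  | _ m ih =>
    by_cases hmk : m < k
    · rw [recExt_of_lt _ _ hmk, recExt_of_lt _ _ hmk]
    · obtain ⟨j, rfl⟩ : ∃ j, m = j + k := ⟨m - k, by omega⟩
      rw [eq_neg_of_add_eq_zero_left (recExt_add q a j),
        eq_neg_of_add_eq_zero_left (recExt_add (fun l => f (q l)) (fun i => f (a i)) j), map_neg,
        map_sum]
      congr 1
      exact Finset.sum_congr rfl fun l _ => by rw [map_mul, ih _ (by omega)]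

/-- The coefficients of the recursion of order `k` that is satisfied by the first `2 * k` terms of
a sequence whose leading Hankel matrix of order `k` is nonsingular. -/
noncomputable def recCoeff (k : ℕ) (a : ℕ → ℂ) : Fin k → ℂ :=
  -((hankelOf k a)⁻¹.mulVec fun i => a (i + k))

theorem hankelOf_mulVec {a : ℕ → R} (q : Fin k → R) (i : Fin k) :
    (hankelOf k a).mulVec q i = ∑ l : Fin k, q l * a (i + l) := by
  simp [Matrix.mulVec, dotProduct, mul_comm]

theorem recCoeff_spec {a : ℕ → ℂ} (h : (hankelOf k a).det ≠ 0) {i : ℕ} (hi : i < k) :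
    a (i + k) + ∑ l : Fin k, recCoeff k a l * a (i + l) = 0 := by
  have h1 := hankelOf_mulVec (a := a) (recCoeff k a) ⟨i, hi⟩
  rw [recCoeff, Matrix.mulVec_neg, Matrix.mulVec_mulVec,
    Matrix.mul_nonsing_inv _ (isUnit_iff_ne_zero.2 h), Matrix.one_mulVec] at h1
  rw [recCoeff, ← h1]
  simp

theorem eq_recCoeff {a : ℕ → ℂ} (h : (hankelOf k a).det ≠ 0) {q : Fin k → ℂ}
    (hq : ∀ i < k, a (i + k) + ∑ l : Fin k, q l * a (i + l) = 0) : q = recCoeff k a := by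
  have h1 : (hankelOf k a).mulVec q = -fun i : Fin k => a (i + k) := by
    funext i
    rw [hankelOf_mulVec]
    exact eq_neg_of_add_eq_zero_right (hq i i.2)
  rw [recCoeff, ← Matrix.mulVec_neg, ← h1, Matrix.mulVec_mulVec,
    Matrix.nonsing_inv_mul _ (isUnit_iff_ne_zero.2 h), Matrix.one_mulVec]

/-- The continuation of `a 0, …, a (2 * k - 1)` by the recursion of order `k` that they satisfy. -/
noncomputable def centralExt (k : ℕ) (a : ℕ → ℂ) : ℕ → ℂ := recExt (recCoeff k a) a

theorem centralExt_of_lt {a : ℕ → ℂ} (h : (hankelOf k a).det ≠ 0) {m : ℕ} (hm : m < 2 * k) :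
    centralExt k a m = a m :=
  recExt_eq_of_rec (M := 2 * k) (fun _ hj => recCoeff_spec h (by omega)) hm

theorem centralExt_add (a : ℕ → ℂ) (m : ℕ) :
    centralExt k a (m + k) + ∑ l : Fin k, recCoeff k a l * centralExt k a (m + l) = 0 :=
  recExt_add _ _ _

theorem recCoeff_congr {a b : ℕ → ℂ} (h : ∀ m < 2 * k, a m = b m) :
    recCoeff k a = recCoeff k b := by
  rw [recCoeff, recCoeff, hankelOf_congr h]
  congr 2
  funext i
  exact h _ (by omega)

theorem centralExt_congr {a b : ℕ → ℂ} (h : ∀ m < 2 * k, a m = b m) :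
    centralExt k a = centralExt k b := by
  rw [centralExt, centralExt, recCoeff_congr h]
  exact recExt_congr fun m hm => h m (by omega)

section Smooth

variable {V : Type*} [NormedAddCommGroup V] [NormedSpace ℝ V] {s : Set V} {a : V → ℕ → ℂ}

theorem contDiffOn_recCoeff (ha : ∀ m, ContDiffOn ℝ ∞ (fun x => a x m) s)
    (h0 : ∀ x ∈ s, (hankelOf k (a x)).det ≠ 0) (l : Fin k) :
    ContDiffOn ℝ ∞ (fun x => recCoeff k (a x) l) s := by
  simp only [recCoeff, Pi.neg_apply, Matrix.mulVec, dotProduct]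
  exact (ContDiffOn.sum fun i _ =>
    (contDiffOn_inv_apply (fun i j => ha _) h0 l i).mul (ha _)).neg

theorem contDiffOn_centralExt (ha : ∀ m, ContDiffOn ℝ ∞ (fun x => a x m) s)
    (h0 : ∀ x ∈ s, (hankelOf k (a x)).det ≠ 0) (m : ℕ) :
    ContDiffOn ℝ ∞ (fun x => centralExt k (a x) m) s := by
  induction m using Nat.strong_induction_on with
  | _ m ih =>
    by_cases hmk : m < k
    · simpa only [centralExt, recExt_of_lt _ _ hmk] using ha m
    · obtain ⟨j, rfl⟩ : ∃ j, m = j + k := ⟨m - k, by omega⟩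
      simp only [eq_neg_of_add_eq_zero_left (centralExt_add _ j)]
      exact (ContDiffOn.sum fun l _ => (contDiffOn_recCoeff ha h0 l).mul (ih _ (by omega))).neg

end Smooth

end Recursions

/-! ### The strata and their dimensions -/

section Strata

variable {N p s : ℕ} {c : ℂ}

/-- The Hankel matrices whose leading minor of order `p` does not vanish and whose antidiagonals,
except for the last `s` ones, satisfy a recursion of order `p`. -/
def stratum (N p s : ℕ) (c : ℂ) : Set (Matrix (Fin N) (Fin N) ℂ) :=
  {X | X ∈ hankelMatrices N ∧ (hankelOf p (hankelSeq c X)).det ≠ 0 ∧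
    ∀ m, m + 1 + s < 2 * N → hankelSeq c X m = centralExt p (hankelSeq c X) m}

/-- The antidiagonals that are free in `stratum N p s`. -/
def stratumIndex (N p s : ℕ) : Finset ℕ :=
  (Finset.range (2 * N - 1)).filter fun m => ¬(2 * p ≤ m ∧ m + 1 + s < 2 * N)

theorem notMem_stratumIndex {m : ℕ} (hm : m + 1 < 2 * N) :
    m ∉ stratumIndex N p s ↔ 2 * p ≤ m ∧ m + 1 + s < 2 * N := by
  simp only [stratumIndex, Finset.mem_filter, Finset.mem_range]
  omega

theorem card_stratumIndex (h : 2 * p + s < 2 * N) : (stratumIndex N p s).card = 2 * p + s := by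
  have : stratumIndex N p s = Finset.range (2 * p) ∪ Finset.Ico (2 * N - 1 - s) (2 * N - 1) := by
    ext m
    simp only [stratumIndex, Finset.mem_filter, Finset.mem_range, Finset.mem_union, Finset.mem_Ico]
    omega
  rw [this, Finset.card_union_of_disjoint, Finset.card_range, Nat.card_Ico]
  · omega
  · rw [Finset.disjoint_left]
    intro m
    simp only [Finset.mem_range, Finset.mem_Ico]
    omega

/-- The dimension of `stratum N p s`. -/
noncomputable def stratumDim (N p s : ℕ) : ℕ :=
  Module.finrank ℝ (LinearMap.range (hankelCoord N (stratumIndex N p s)))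

theorem stratumDim_eq (h : 2 * p + s < 2 * N) : stratumDim N p s = 2 * (2 * p + s) := by
  rw [stratumDim, finrank_range_hankelCoord, card_stratumIndex h]
  intro m hm
  simp only [stratumIndex, Finset.mem_filter, Finset.mem_range] at hm
  omega

/-- The part of a matrix in `stratum N p s` that is determined by the free antidiagonals. -/
noncomputable def stratumShear (N p s : ℕ) (c : ℂ) (X : Matrix (Fin N) (Fin N) ℂ) :
    Matrix (Fin N) (Fin N) ℂ :=
  hankelOf N fun m =>
    if 2 * p ≤ m ∧ m + 1 + s < 2 * N then centralExt p (hankelSeq c X) m else 0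

/-- The correction reads only the first `2 * p` antidiagonals, which it does not alter. Hence
subtracting and adding it are inverse to each other. -/
theorem stratumShear_congr {X Y : Matrix (Fin N) (Fin N) ℂ}
    (h : ∀ m < 2 * p, hankelSeq c X m = hankelSeq c Y m) :
    stratumShear N p s c X = stratumShear N p s c Y := by
  rw [stratumShear, stratumShear, centralExt_congr h]

theorem hankelSeq_stratumShear {X : Matrix (Fin N) (Fin N) ℂ} {m : ℕ} (hm : m + 1 < 2 * N) :
    hankelSeq c (stratumShear N p s c X) m =
      if 2 * p ≤ m ∧ m + 1 + s < 2 * N then centralExt p (hankelSeq c X) m else 0 :=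
  hankelSeq_hankelOf _ _ hm

theorem hankelSeq_sub_stratumShear {X : Matrix (Fin N) (Fin N) ℂ} {m : ℕ} (hm : m < 2 * p) :
    hankelSeq c (X - stratumShear N p s c X) m = hankelSeq c X m := by
  by_cases h : m + 1 < 2 * N
  · rw [hankelSeq_sub _ _ _ h, hankelSeq_stratumShear h, if_neg (by omega), sub_zero]
  · rw [hankelSeq_of_le _ _ (by omega), hankelSeq_of_le _ _ (by omega)]

theorem hankelSeq_add_stratumShear {X : Matrix (Fin N) (Fin N) ℂ} {m : ℕ} (hm : m < 2 * p) :
    hankelSeq c (X + stratumShear N p s c X) m = hankelSeq c X m := by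
  by_cases h : m + 1 < 2 * N
  · rw [hankelSeq_add _ _ _ h, hankelSeq_stratumShear h, if_neg (by omega), add_zero]
  · rw [hankelSeq_of_le _ _ (by omega), hankelSeq_of_le _ _ (by omega)]

theorem isOpen_leading_det_ne_zero (N p : ℕ) (c : ℂ) :
    IsOpen {X : Matrix (Fin N) (Fin N) ℂ | (hankelOf p (hankelSeq c X)).det ≠ 0} := by
  have : ContDiffOn ℝ ∞
      (fun X : Matrix (Fin N) (Fin N) ℂ => (hankelOf p (hankelSeq c X)).det) univ :=
    contDiffOn_det fun i j => (contDiff_hankelSeq c _).contDiffOn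
  exact isOpen_ne.preimage (continuousOn_univ.1 this.continuousOn)

theorem isManifoldAt_stratum {A : Matrix (Fin N) (Fin N) ℂ} (hA : A ∈ stratum N p s c) :
    IsManifoldAt (stratumDim N p s) (stratum N p s c) A := by
  refine isManifoldAt_of_shear (U := {X | (hankelOf p (hankelSeq c X)).det ≠ 0}) _
    (stratumShear N p s c) (isOpen_leading_det_ne_zero N p c) ?_ ?_ ?_ hA.2.1 hA ?_
  · refine contDiffOn_matrix fun i j => ?_
    simp only [stratumShear, hankelOf_apply]
    split_ifs
    · exact contDiffOn_centralExt (fun m => (contDiff_hankelSeq c m).contDiffOn) (fun X hX => hX) _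
    · exact contDiffOn_const
  · intro X hX
    refine ⟨?_, stratumShear_congr fun m hm => hankelSeq_sub_stratumShear hm⟩
    rw [mem_ofPred_eq, hankelOf_congr fun m hm => hankelSeq_sub_stratumShear hm]
    exact hX
  · intro X hX
    refine ⟨?_, stratumShear_congr fun m hm => hankelSeq_add_stratumShear hm⟩
    rw [mem_ofPred_eq, hankelOf_congr fun m hm => hankelSeq_add_stratumShear hm]
    exact hX
  · intro X hX
    have hH : X - stratumShear N p s c X ∈ hankelMatrices N ↔ X ∈ hankelMatrices N :=
      (hankelSubmodule N).sub_mem_iff_left (hankelOf_mem _)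
    rw [mem_range_hankelCoord c, hH]
    refine ⟨fun h => ⟨h.1, fun m hm hms => ?_⟩, fun h => ⟨h.1, hX, fun m hm => ?_⟩⟩
    · have hms' := (notMem_stratumIndex hm).1 hms
      rw [hankelSeq_sub _ _ _ hm, hankelSeq_stratumShear hm, if_pos hms', ← h.2.2 m hms'.2,
        sub_self]
    · by_cases hmp : m < 2 * p
      · exact (centralExt_of_lt hX hmp).symm
      · have h1 := h.2 m (by omega) ((notMem_stratumIndex (by omega)).2 (by omega))
        rw [hankelSeq_sub _ _ _ (by omega), hankelSeq_stratumShear (by omega),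
          if_pos (by omega)] at h1
        exact sub_eq_zero.1 h1

/-- The first `p` equations already force `q` to be `recCoeff`; `hps` ensures that they lie in the
range where `hq` applies. -/
theorem mem_stratum_of_rec {X : Matrix (Fin N) (Fin N) ℂ} (hX : X ∈ hankelMatrices N)
    (h : (hankelOf p (hankelSeq c X)).det ≠ 0) (hps : 2 * p + s < 2 * N) {q : Fin p → ℂ}
    (hq : ∀ j, j + p + 1 + s < 2 * N →
      hankelSeq c X (j + p) + ∑ l : Fin p, q l * hankelSeq c X (j + l) = 0) :
    X ∈ stratum N p s c := by
  have hq' : q = recCoeff p (hankelSeq c X) := eq_recCoeff h fun i hi => hq i (by omega)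
  refine ⟨hX, h, fun m hm => ?_⟩
  rw [centralExt, ← hq', recExt_eq_of_rec (M := 2 * N - 1 - s) (fun j hj => hq j (by omega))
    (by omega)]

end Strata

/-! ### The rank variety near a point with nonsingular leading corner -/

section Rank

variable {N k : ℕ} (h : k ≤ N)

/-- The first `k` columns. -/
def leadingCols (X : Matrix (Fin N) (Fin N) ℂ) : Matrix (Fin N) (Fin k) ℂ :=
  X.submatrix id (Fin.castLE h)

/-- The first `k` rows. -/
def leadingRows (X : Matrix (Fin N) (Fin N) ℂ) : Matrix (Fin k) (Fin N) ℂ :=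
  X.submatrix (Fin.castLE h) id

/-- The upper left corner of order `k`. -/
def leadingCorner (X : Matrix (Fin N) (Fin N) ℂ) : Matrix (Fin k) (Fin k) ℂ :=
  X.submatrix (Fin.castLE h) (Fin.castLE h)

/-- The matrix of rank at most `k` that has the same first `k` rows and columns as `X`. -/
noncomputable def rankCompletion (X : Matrix (Fin N) (Fin N) ℂ) : Matrix (Fin N) (Fin N) ℂ :=
  leadingCols h X * (leadingCorner h X)⁻¹ * leadingRows h X

/-- The inclusion of the first `k` coordinates. -/
def leadingInclusion : Matrix (Fin N) (Fin k) ℂ :=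
  (1 : Matrix (Fin N) (Fin N) ℂ).submatrix id (Fin.castLE h)

theorem mul_leadingInclusion (X : Matrix (Fin N) (Fin N) ℂ) :
    X * leadingInclusion h = leadingCols h X := by
  ext i j
  simp [leadingInclusion, leadingCols, Matrix.mul_apply, Matrix.one_apply]

theorem leadingRows_mul_leadingInclusion (X : Matrix (Fin N) (Fin N) ℂ) :
    leadingRows h X * leadingInclusion h = leadingCorner h X := by
  ext i j
  simp [leadingInclusion, leadingCorner, leadingRows, Matrix.mul_apply, Matrix.one_apply]

variable {h} {X : Matrix (Fin N) (Fin N) ℂ}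

theorem leadingRows_mulVec_apply (w : Fin N → ℂ) (i : Fin k) :
    (leadingRows h X).mulVec w i = X.mulVec w (Fin.castLE h i) := rfl

/-- The kernel of `X` lies in that of its leading rows. These have rank at least `k` because of the
corner, so a dimension count makes the kernels equal. -/
theorem mulVec_eq_zero_of_leadingRows (hdet : (leadingCorner h X).det ≠ 0) (hX : X.rank ≤ k)
    {w : Fin N → ℂ} (hw : (leadingRows h X).mulVec w = 0) : X.mulVec w = 0 := by
  have hle : LinearMap.ker X.mulVecLin ≤ LinearMap.ker (leadingRows h X).mulVecLin := by
    intro w hw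
    rw [LinearMap.mem_ker, Matrix.mulVecLin_apply] at hw ⊢
    funext i
    rw [leadingRows_mulVec_apply, hw]
    rfl
  have hk : k ≤ (leadingRows h X).rank := by
    have h1 := Matrix.rank_mul_le_left (leadingRows h X) (leadingInclusion h)
    rw [leadingRows_mul_leadingInclusion, Matrix.rank_of_isUnit _
      ((Matrix.isUnit_iff_isUnit_det _).2 (isUnit_iff_ne_zero.2 hdet)), Fintype.card_fin] at h1
    exact h1
  have e1 := LinearMap.finrank_range_add_finrank_ker X.mulVecLin
  have e2 := LinearMap.finrank_range_add_finrank_ker (leadingRows h X).mulVecLin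
  have heq := Submodule.eq_of_le_of_finrank_le hle (by
    change X.rank + _ = _ at e1
    change (leadingRows h X).rank + _ = _ at e2
    omega)
  have : w ∈ LinearMap.ker (leadingRows h X).mulVecLin := hw
  rwa [← heq] at this

theorem rank_rankCompletion_le (X : Matrix (Fin N) (Fin N) ℂ) : (rankCompletion h X).rank ≤ k :=
  (Matrix.rank_mul_le_right _ _).trans
    ((Matrix.rank_le_card_height _).trans_eq (Fintype.card_fin k))

/-- The leading rows annihilate `1 - J * C⁻¹ * R`, where `J` is the inclusion, `C` the corner and
`R` the leading rows. Hence `X` annihilates it too, and `X * J` consists of the leading columns. -/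
theorem eq_rankCompletion (hdet : (leadingCorner h X).det ≠ 0) (hX : X.rank ≤ k) :
    X = rankCompletion h X := by
  have hZ : leadingRows h X *
      (1 - leadingInclusion h * (leadingCorner h X)⁻¹ * leadingRows h X) = 0 := by
    rw [Matrix.mul_sub, ← Matrix.mul_assoc, ← Matrix.mul_assoc, leadingRows_mul_leadingInclusion,
      Matrix.mul_nonsing_inv _ (isUnit_iff_ne_zero.2 hdet), Matrix.mul_one, Matrix.one_mul,
      sub_self]
  have hXZ : X * (1 - leadingInclusion h * (leadingCorner h X)⁻¹ * leadingRows h X) = 0 := by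
    ext i j
    have h1 : (leadingRows h X).mulVec (fun i =>
        (1 - leadingInclusion h * (leadingCorner h X)⁻¹ * leadingRows h X :
          Matrix (Fin N) (Fin N) ℂ) i j) = 0 :=
      funext fun l => congrFun (congrFun hZ l) j
    exact congrFun (mulVec_eq_zero_of_leadingRows hdet hX h1) i
  rw [Matrix.mul_sub, ← Matrix.mul_assoc, ← Matrix.mul_assoc, mul_leadingInclusion,
    Matrix.mul_one, sub_eq_zero] at hXZ
  exact hXZ

theorem rankCompletion_apply_of_lt (hdet : (leadingCorner h X).det ≠ 0) {i j : Fin N}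
    (hij : (i : ℕ) < k ∨ (j : ℕ) < k) : rankCompletion h X i j = X i j := by
  rcases hij with hi | hj
  · have h1 : leadingCorner h X * (leadingCorner h X)⁻¹ * leadingRows h X = leadingRows h X := by
      rw [Matrix.mul_nonsing_inv _ (isUnit_iff_ne_zero.2 hdet), Matrix.one_mul]
    simpa [Matrix.mul_apply, leadingRows, leadingCorner, rankCompletion, leadingCols] using
      congrFun (congrFun h1 ⟨i, hi⟩) j
  · have h1 : leadingCols h X * (leadingCorner h X)⁻¹ * leadingCorner h X = leadingCols h X := by
      rw [Matrix.mul_assoc, Matrix.nonsing_inv_mul _ (isUnit_iff_ne_zero.2 hdet), Matrix.mul_one]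
    simpa [Matrix.mul_apply, leadingRows, leadingCorner, rankCompletion, leadingCols] using
      congrFun (congrFun h1 i) ⟨j, hj⟩

theorem rankCompletion_congr {Y : Matrix (Fin N) (Fin N) ℂ}
    (hXY : ∀ i j : Fin N, (i : ℕ) < k ∨ (j : ℕ) < k → X i j = Y i j) :
    leadingCorner h X = leadingCorner h Y ∧ rankCompletion h X = rankCompletion h Y := by
  have h1 : leadingCorner h X = leadingCorner h Y := by
    ext i j
    exact hXY _ _ (Or.inl i.2)
  have h2 : leadingCols h X = leadingCols h Y := by
    ext i j
    exact hXY _ _ (Or.inr j.2)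
  have h3 : leadingRows h X = leadingRows h Y := by
    ext i j
    exact hXY _ _ (Or.inl i.2)
  exact ⟨h1, by rw [rankCompletion, rankCompletion, h1, h2, h3]⟩

variable (h)

theorem isOpen_leadingCorner_det_ne_zero :
    IsOpen {X : Matrix (Fin N) (Fin N) ℂ | (leadingCorner h X).det ≠ 0} := by
  have : ContDiffOn ℝ ∞
      (fun X : Matrix (Fin N) (Fin N) ℂ => (leadingCorner h X).det) univ :=
    contDiffOn_det fun i j => (contDiff_entry _ _).contDiffOn
  exact isOpen_ne.preimage (continuousOn_univ.1 this.continuousOn)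

/-- The matrices whose lower right block vanishes. -/
def lowerBlockZero (N k : ℕ) : Submodule ℝ (Matrix (Fin N) (Fin N) ℂ) where
  carrier := {X | ∀ i j : Fin N, k ≤ i → k ≤ j → X i j = 0}
  add_mem' {A B} hA hB i j hi hj := by simp [hA i j hi hj, hB i j hi hj]
  zero_mem' i j _ _ := rfl
  smul_mem' r A hA i j hi hj := by simp [hA i j hi hj]

theorem mem_lowerBlockZero :
    X ∈ lowerBlockZero N k ↔ ∀ i j : Fin N, k ≤ i → k ≤ j → X i j = 0 := Iff.rfl

/-- The lower right block of `rankCompletion`. -/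
noncomputable def rankShear (X : Matrix (Fin N) (Fin N) ℂ) : Matrix (Fin N) (Fin N) ℂ :=
  Matrix.of fun i j => if k ≤ (i : ℕ) ∧ k ≤ (j : ℕ) then rankCompletion h X i j else 0

theorem rankShear_apply_of_lt {i j : Fin N} (hij : (i : ℕ) < k ∨ (j : ℕ) < k) :
    rankShear h X i j = 0 := by
  rw [rankShear, Matrix.of_apply, if_neg (by omega)]

/-- Where the corner is nonsingular, rank at most `k` means that the lower right block is a certain
smooth function of the other entries, so the set is a graph. -/
theorem isManifoldAt_rankLE (hdet : (leadingCorner h X).det ≠ 0) (hX : X.rank ≤ k) :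
    ∃ d, IsManifoldAt d (rankLE N k) X := by
  have hsub : ∀ Y, leadingCorner h (Y - rankShear h Y) = leadingCorner h Y ∧
      rankCompletion h (Y - rankShear h Y) = rankCompletion h Y := fun Y =>
    rankCompletion_congr fun i j hij => by
      rw [Matrix.sub_apply, rankShear_apply_of_lt h hij, sub_zero]
  have hadd : ∀ Y, leadingCorner h (Y + rankShear h Y) = leadingCorner h Y ∧
      rankCompletion h (Y + rankShear h Y) = rankCompletion h Y := fun Y =>
    rankCompletion_congr fun i j hij => by
      rw [Matrix.add_apply, rankShear_apply_of_lt h hij, add_zero]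
  refine ⟨_, isManifoldAt_of_shear (U := {Y | (leadingCorner h Y).det ≠ 0}) (lowerBlockZero N k)
    (rankShear h) (isOpen_leadingCorner_det_ne_zero h) ?_ ?_ ?_ hdet hX ?_⟩
  · refine contDiffOn_matrix fun i j => ?_
    simp only [rankShear, Matrix.of_apply]
    split_ifs
    · simp only [rankCompletion, Matrix.mul_apply]
      exact ContDiffOn.sum fun m _ => (ContDiffOn.sum fun l _ =>
        (contDiff_entry _ _).contDiffOn.mul (contDiffOn_inv_apply
          (fun a b => (contDiff_entry _ _).contDiffOn) (fun Y hY => hY) l m)).mul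
            (contDiff_entry _ _).contDiffOn
    · exact contDiffOn_const
  · intro Y hY
    refine ⟨?_, ?_⟩
    · rw [mem_ofPred_eq, (hsub Y).1]
      exact hY
    · conv_lhs => rw [rankShear, (hsub Y).2]
      rfl
  · intro Y hY
    refine ⟨?_, ?_⟩
    · rw [mem_ofPred_eq, (hadd Y).1]
      exact hY
    · conv_lhs => rw [rankShear, (hadd Y).2]
      rfl
  · intro Y hY
    rw [mem_lowerBlockZero]
    refine ⟨fun hr i j hi hj => ?_, fun hF => ?_⟩
    · rw [Matrix.sub_apply, rankShear, Matrix.of_apply, if_pos ⟨hi, hj⟩,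
        ← eq_rankCompletion hY hr, sub_self]
    · suffices Y = rankCompletion h Y by
        rw [this]
        exact rank_rankCompletion_le Y
      ext i j
      by_cases hij : (i : ℕ) < k ∨ (j : ℕ) < k
      · exact (rankCompletion_apply_of_lt hY hij).symm
      · have h1 := hF i j (by omega) (by omega)
        rw [Matrix.sub_apply, rankShear, Matrix.of_apply, if_pos (by omega)] at h1
        exact sub_eq_zero.1 h1

theorem hasDerivAt_entry {γ : ℝ → Matrix (Fin N) (Fin N) ℂ} {v : Matrix (Fin N) (Fin N) ℂ}
    (hγ : HasDerivAt γ v 0) (i j : Fin N) : HasDerivAt (fun t => γ t i j) (v i j) 0 :=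
  (entryCLM i j).hasFDerivAt.comp_hasDerivAt (0 : ℝ) hγ

/-- A tangent vector of `rankLE N k` annihilates left null vectors paired with null vectors. -/
theorem bilin_eq_zero_of_mem_tangentVectors (hdet : (leadingCorner h X).det ≠ 0)
    {v : Matrix (Fin N) (Fin N) ℂ} (hv : v ∈ tangentVectors (rankLE N k) X) {u w : Fin N → ℂ}
    (hu : X.vecMul u = 0) (hw : X.mulVec w = 0) : ∑ i, ∑ j, u i * v i j * w j = 0 := by
  obtain ⟨γ, rfl, hγ, hd⟩ := hv
  have hopen := isOpen_leadingCorner_det_ne_zero (N := N) h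
  have hev : ∀ᶠ t in 𝓝 (0 : ℝ), (leadingCorner h (γ t)).det ≠ 0 :=
    hd.continuousAt.eventually (hopen.mem_nhds hdet)
  have hL : HasDerivAt (fun t => ∑ i, ∑ j, u i * γ t i j * w j)
      (∑ i, ∑ j, u i * v i j * w j) 0 :=
    HasDerivAt.fun_sum fun i _ => HasDerivAt.fun_sum fun j _ =>
      ((hasDerivAt_entry hd i j).const_mul (u i)).mul_const (w j)
  -- Since `γ t` is its own rank completion, the pairing is the product of `u` applied to the
  -- leading columns with the inverse corner applied to the leading rows times `w`. Both factors
  -- vanish at `t = 0`, so the product rule gives derivative zero.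
  have hf : ∀ l : Fin k, ∃ f', HasDerivAt (fun t => ∑ i, u i * γ t i (Fin.castLE h l)) f' 0 :=
    fun l => ⟨_, HasDerivAt.fun_sum fun i _ => (hasDerivAt_entry hd i _).const_mul (u i)⟩
  have hg : ∀ l : Fin k, ∃ g', HasDerivAt (fun t => ∑ m, (leadingCorner h (γ t))⁻¹ l m *
      ∑ j, γ t (Fin.castLE h m) j * w j) g' 0 := by
    intro l
    have hinv : ∀ m, DifferentiableAt ℝ (fun t => (leadingCorner h (γ t))⁻¹ l m) 0 := by
      intro m
      have h1 : ContDiffOn ℝ ∞ (fun Y : Matrix (Fin N) (Fin N) ℂ => (leadingCorner h Y)⁻¹ l m)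
          {Y | (leadingCorner h Y).det ≠ 0} :=
        contDiffOn_inv_apply (fun a b => (contDiff_entry _ _).contDiffOn) (fun Y hY => hY) l m
      exact ((h1.contDiffAt (hopen.mem_nhds hdet)).differentiableAt (by simp)).comp 0
        hd.differentiableAt
    exact ⟨_, HasDerivAt.fun_sum fun m _ => (hinv m).hasDerivAt.mul
      (HasDerivAt.fun_sum fun j _ => (hasDerivAt_entry hd _ j).mul_const (w j))⟩
  choose f' hf using hf
  choose g' hg using hg
  have hR := HasDerivAt.fun_sum (u := Finset.univ) fun l _ => (hf l).mul (hg l)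
  have hf0 : ∀ l : Fin k, ∑ i, u i * γ 0 i (Fin.castLE h l) = 0 := fun l =>
    congrFun hu (Fin.castLE h l)
  have hg0 : ∀ m : Fin k, ∑ j, γ 0 (Fin.castLE h m) j * w j = 0 := fun m =>
    congrFun hw (Fin.castLE h m)
  simp only [hf0, hg0, mul_zero, zero_mul, Finset.sum_const_zero, add_zero] at hR
  refine hL.unique (hR.congr_of_eventuallyEq ?_)
  filter_upwards [hγ, hev] with t ht htd
  have h1 := eq_rankCompletion htd ht
  have h2 : ∀ M : Matrix (Fin N) (Fin N) ℂ,
      ∑ i, ∑ j, u i * M i j * w j = dotProduct u (M.mulVec w) := fun M => by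
    simp [dotProduct, Matrix.mulVec, Finset.mul_sum, mul_assoc]
  simp only [Pi.mul_apply]
  change _ = dotProduct (Matrix.vecMul u (leadingCols h (γ t)))
    ((leadingCorner h (γ t))⁻¹.mulVec ((leadingRows h (γ t)).mulVec w))
  rw [h2, ← Matrix.dotProduct_mulVec, Matrix.mulVec_mulVec, Matrix.mulVec_mulVec,
    ← rankCompletion, ← h1]

end Rank

/-! ### Covering the Hankel matrices of bounded rank by strata -/

section Coverage

variable {N : ℕ} {a : ℕ → ℂ}

/-- A first linear dependency between the columns of a singular Hankel matrix. -/
theorem exists_first_dependency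
    (h : ∃ v : ℕ → ℂ, (∃ l < N, v l ≠ 0) ∧ ∀ i < N, ∑ l ∈ Finset.range N, v l * a (i + l) = 0) :
    ∃ p < N, (∃ q : ℕ → ℂ, ∀ i < N, a (i + p) + ∑ l ∈ Finset.range p, q l * a (i + l) = 0) ∧
      ∀ v : ℕ → ℂ, (∀ i < N, ∑ l ∈ Finset.range p, v l * a (i + l) = 0) → ∀ l < p, v l = 0 := by
  classical
  let Q : ℕ → Prop := fun p =>
    ∃ v : ℕ → ℂ, (∃ l < p, v l ≠ 0) ∧ ∀ i < N, ∑ l ∈ Finset.range p, v l * a (i + l) = 0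
  have hQ : ∃ p, Q p := ⟨N, h⟩
  obtain ⟨v, ⟨l, hl, hvl⟩, hv⟩ := Nat.find_spec hQ
  have hmin : ∀ p < Nat.find hQ, ¬Q p := fun p hp => Nat.find_min hQ hp
  have hle : Nat.find hQ ≤ N := Nat.find_min' hQ h
  generalize Nat.find hQ = n at *
  obtain ⟨p, rfl⟩ : ∃ p, n = p + 1 := ⟨n - 1, by omega⟩
  have hind : ∀ v : ℕ → ℂ, (∀ i < N, ∑ l ∈ Finset.range p, v l * a (i + l) = 0) →
      ∀ l < p, v l = 0 := by
    intro v hv l hl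
    by_contra hne
    exact hmin p (by omega) ⟨v, ⟨l, hl, hne⟩, hv⟩
  -- By minimality the first `p` columns are independent, so the last coefficient is nonzero and can
  -- be normalised to 1.
  have hvp : v p ≠ 0 := by
    intro h0
    have h1 := hind v fun i hi => by simpa [Finset.sum_range_succ, h0] using hv i hi
    rcases Nat.lt_succ_iff_lt_or_eq.1 hl with h2 | rfl
    · exact hvl (h1 l h2)
    · exact hvl h0
  refine ⟨p, by omega, ⟨fun l => v l / v p, fun i hi => ?_⟩, hind⟩
  have h1 := hv i hi
  rw [Finset.sum_range_succ] at h1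
  have h2 : ∑ l ∈ Finset.range p, v l / v p * a (i + l) =
      (∑ l ∈ Finset.range p, v l * a (i + l)) / v p := by
    rw [Finset.sum_div]
    exact Finset.sum_congr rfl fun l _ => by ring
  rw [h2, eq_neg_of_add_eq_zero_left h1]
  field_simp
  ring

/-- By the Hankel symmetry the recursion among columns is also one among rows. A null vector of the
corner therefore kills all `N` rows of the first `p` columns, which are independent. -/
theorem leading_det_ne_zero {p : ℕ} {q : ℕ → ℂ}
    (hq : ∀ i < N, a (i + p) + ∑ l ∈ Finset.range p, q l * a (i + l) = 0)
    (hind : ∀ v : ℕ → ℂ, (∀ i < N, ∑ l ∈ Finset.range p, v l * a (i + l) = 0) → ∀ l < p, v l = 0) :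
    (hankelOf p a).det ≠ 0 := by
  intro h0
  obtain ⟨w, hw0, hw⟩ := Matrix.exists_mulVec_eq_zero_iff.2 h0
  let v : ℕ → ℂ := fun l => if h : l < p then w ⟨l, h⟩ else 0
  have hv : ∀ i < p, ∑ l ∈ Finset.range p, v l * a (i + l) = 0 := by
    intro i hi
    have h1 := congrFun hw ⟨i, hi⟩
    rw [hankelOf_mulVec] at h1
    rw [← Fin.sum_univ_eq_sum_range (fun l => v l * a (i + l))]
    simpa [v] using h1
  have hv' : ∀ i < N, ∑ l ∈ Finset.range p, v l * a (i + l) = 0 := by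
    intro i
    induction i using Nat.strong_induction_on with
    | _ i ih =>
      intro hi
      by_cases hip : i < p
      · exact hv i hip
      · obtain ⟨j, rfl⟩ : ∃ j, i = j + p := ⟨i - p, by omega⟩
        calc ∑ l ∈ Finset.range p, v l * a (j + p + l)
            = ∑ l ∈ Finset.range p, v l * -∑ m ∈ Finset.range p, q m * a (j + l + m) := by
              refine Finset.sum_congr rfl fun l hl => ?_
              rw [Finset.mem_range] at hl
              rw [← eq_neg_of_add_eq_zero_left (hq (j + l) (by omega)), add_right_comm]
          _ = -∑ m ∈ Finset.range p, q m * ∑ l ∈ Finset.range p, v l * a (j + m + l) := by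
              simp only [Finset.mul_sum, mul_neg, Finset.sum_neg_distrib]
              rw [Finset.sum_comm]
              congr 1
              refine Finset.sum_congr rfl fun m _ => Finset.sum_congr rfl fun l _ => ?_
              rw [add_right_comm j l m]
              ring
          _ = 0 := by
              rw [Finset.sum_eq_zero, neg_zero]
              intro m hm
              rw [Finset.mem_range] at hm
              rw [ih (j + m) (by omega) (by omega), mul_zero]
  apply hw0
  funext l
  simpa [v] using hind v hv' l l.2

/-- The number of independent columns of a Hankel matrix is at least the order of the recursion of
its first columns plus the number of the antidiagonals that deviate from it. -/
theorem null_vector_eq_zero {p s : ℕ} {q : ℕ → ℂ} {e : ℕ → ℂ} (hps : p + s < N)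
    (he : ∀ j, e j = a (j + p) + ∑ l ∈ Finset.range p, q l * a (j + l))
    (hs : ∀ j, j + p + 1 + s < 2 * N → e j = 0) (hs' : 0 < s → e (2 * N - 1 - p - s) ≠ 0)
    (hind : ∀ v : ℕ → ℂ, (∀ i < N, ∑ l ∈ Finset.range p, v l * a (i + l) = 0) → ∀ l < p, v l = 0)
    {v : ℕ → ℂ} (hv : ∀ i < N, ∑ l ∈ Finset.range N, v l * a (i + l) = 0)
    (hv0 : ∀ l, p ≤ l → l + s < N → v l = 0) : ∀ l < N, v l = 0 := by
  -- Combining the null equations of the rows `i, …, i + p` according to the recursion replaces `a`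
  -- by its defect `e`.
  have hve : ∀ i, i + p < N → ∑ l ∈ Finset.range N, v l * e (i + l) = 0 := by
    intro i hi
    calc ∑ l ∈ Finset.range N, v l * e (i + l)
        = ∑ l ∈ Finset.range N, v l * a (i + p + l) +
            ∑ m ∈ Finset.range p, q m * ∑ l ∈ Finset.range N, v l * a (i + m + l) := by
          simp only [he, mul_add, Finset.sum_add_distrib, Finset.mul_sum]
          rw [Finset.sum_comm (s := Finset.range p)]
          congr 1
          · exact Finset.sum_congr rfl fun l _ => by rw [add_right_comm]
          · refine Finset.sum_congr rfl fun l _ => Finset.sum_congr rfl fun m _ => ?_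
            rw [add_right_comm i l m]
            ring
      _ = 0 := by
          rw [hv _ hi, zero_add]
          refine Finset.sum_eq_zero fun m hm => ?_
          rw [Finset.mem_range] at hm
          rw [hv _ (by omega), mul_zero]
  -- The defect starts at index `2 * N - 1 - p - s`, so these equations are triangular in the last
  -- `s` entries of `v`: earlier columns meet zeros of `e`, later ones are settled by induction.
  have htop : ∀ t < s, v (N - 1 - t) = 0 := by
    intro t
    induction t using Nat.strong_induction_on with
    | _ t ih =>
      intro ht
      have h1 := hve (N - p - s + t) (by omega)
      rw [Finset.sum_eq_single (N - 1 - t)] at h1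
      · rw [show N - p - s + t + (N - 1 - t) = 2 * N - 1 - p - s by omega] at h1
        exact (mul_eq_zero.1 h1).resolve_right (hs' (by omega))
      · intro l hl hne
        rw [Finset.mem_range] at hl
        rcases Nat.lt_or_gt_of_ne hne with h2 | h2
        · rw [hs _ (by omega), mul_zero]
        · have h3 := ih (N - 1 - l) (by omega) (by omega)
          rw [show N - 1 - (N - 1 - l) = l by omega] at h3
          rw [h3, zero_mul]
      · intro h2
        rw [Finset.mem_range] at h2
        omega
  have hge : ∀ l, p ≤ l → l < N → v l = 0 := by
    intro l hpl hl
    by_cases hls : l + s < N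
    · exact hv0 l hpl hls
    · have h3 := htop (N - 1 - l) (by omega)
      rwa [show N - 1 - (N - 1 - l) = l by omega] at h3
  have hlt := hind v fun i hi => by
    rw [← hv i hi]
    refine Finset.sum_subset (Finset.range_mono (by omega)) fun l hl hl' => ?_
    rw [Finset.mem_range] at hl hl'
    rw [hge l (by omega) hl, zero_mul]
  intro l hl
  by_cases hlp : l < p
  · exact hlt l hlp
  · exact hge l (by omega) hl

theorem hankelOf_mulVec_apply (w : Fin N → ℂ) (i : Fin N) :
    (hankelOf N a).mulVec w i =
      ∑ l ∈ Finset.range N, (if h : l < N then w ⟨l, h⟩ else 0) * a (i + l) := by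
  rw [hankelOf_mulVec,
    ← Fin.sum_univ_eq_sum_range (fun l => (if h : l < N then w ⟨l, h⟩ else 0) * a (i + l))]
  simp

/-- The Hankel matrices of rank at most `k < N` lie in the strata of rank at most `k`. -/
theorem exists_mem_stratum {k : ℕ} {X : Matrix (Fin N) (Fin N) ℂ} (hX : X ∈ hankelMatrices N)
    (hr : X.rank ≤ k) (hk : k < N) : ∃ p s, p + s ≤ k ∧ X ∈ stratum N p s 0 := by
  classical
  obtain ⟨a, ha⟩ : ∃ a, a = hankelSeq 0 X := ⟨_, rfl⟩
  have hXa : X = hankelOf N a := by rw [ha, hankelOf_hankelSeq 0 hX]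
  have hrn := LinearMap.finrank_range_add_finrank_ker X.mulVecLin
  change X.rank + _ = _ at hrn
  rw [Module.finrank_fin_fun] at hrn
  have hker : LinearMap.ker X.mulVecLin ≠ ⊥ := by
    intro h0
    rw [h0, finrank_bot] at hrn
    omega
  obtain ⟨w, hw, hw0⟩ := Submodule.exists_mem_ne_zero_of_ne_bot hker
  have hnull : ∀ w ∈ LinearMap.ker X.mulVecLin, ∀ i < N,
      ∑ l ∈ Finset.range N, (if h : l < N then w ⟨l, h⟩ else 0) * a (i + l) = 0 := by
    intro w hw i hi
    rw [← hankelOf_mulVec_apply w ⟨i, hi⟩, ← hXa]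
    exact congrFun hw ⟨i, hi⟩
  obtain ⟨l, hl⟩ := Function.ne_iff.1 hw0
  obtain ⟨p, hpN, ⟨q, hq⟩, hind⟩ := exists_first_dependency
    ⟨fun l => if h : l < N then w ⟨l, h⟩ else 0, ⟨l, l.2, by simpa using hl⟩, hnull w hw⟩
  obtain ⟨e, he⟩ : ∃ e : ℕ → ℂ, ∀ j, e j = a (j + p) + ∑ l ∈ Finset.range p, q l * a (j + l) :=
    ⟨_, fun _ => rfl⟩
  -- The least such `s` counts the final antidiagonals back to the first defect. It is at most `N -
  -- 1 - p` since the dependency holds in all `N` rows.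
  have hex : ∃ s, ∀ j, j + p + 1 + s < 2 * N → e j = 0 :=
    ⟨N - 1 - p, fun j hj => by rw [he, hq j (by omega)]⟩
  have hs := Nat.find_spec hex
  have hmin : ∀ s < Nat.find hex, _ := fun s hs => Nat.find_min hex hs
  have hle : Nat.find hex ≤ N - 1 - p :=
    Nat.find_min' hex fun j hj => by rw [he, hq j (by omega)]
  generalize Nat.find hex = s at *
  have hs' : 0 < s → e (2 * N - 1 - p - s) ≠ 0 := by
    intro hs0 h0
    refine hmin (s - 1) (by omega) fun j hj => ?_
    by_cases hj' : j + p + 1 + s < 2 * N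
    · exact hs j hj'
    · rwa [show j = 2 * N - 1 - p - s by omega]
  -- Projection of the kernel to the coordinates between the first `p` and the last `s`. Its
  -- injectivity bounds the nullity by `N - p - s`, hence `p + s ≤ k`.
  let φ : LinearMap.ker X.mulVecLin →ₗ[ℂ] (Fin (N - p - s) → ℂ) :=
    (LinearMap.funLeft ℂ ℂ fun i : Fin (N - p - s) => (⟨p + i, by omega⟩ : Fin N)) ∘ₗ
      (LinearMap.ker X.mulVecLin).subtype
  have hφ : Function.Injective φ := by
    rw [← LinearMap.ker_eq_bot, LinearMap.ker_eq_bot']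
    rintro ⟨w, hw⟩ h0
    have h1 := null_vector_eq_zero (by omega) he hs hs' hind (hnull w hw) (by
      intro l hpl hl
      rw [dif_pos (by omega)]
      have h2 := congrFun h0 ⟨l - p, by omega⟩
      have h3 : (⟨p + (l - p), by omega⟩ : Fin N) = ⟨l, by omega⟩ := Fin.ext (by simp; omega)
      change w ⟨p + (l - p), _⟩ = 0 at h2
      rwa [h3] at h2)
    ext l
    simpa using h1 l l.2
  have hdim := LinearMap.finrank_le_finrank_of_injective hφ
  rw [Module.finrank_fin_fun] at hdim
  have hdet := leading_det_ne_zero hq hind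
  refine ⟨p, s, by omega, mem_stratum_of_rec hX (ha ▸ hdet) (by omega) (q := fun l => q l) ?_⟩
  intro j hj
  rw [← ha, Fin.sum_univ_eq_sum_range (fun l => q l * a (j + l)), ← he]
  exact hs j hj

end Coverage

/-! ### Non-tangentiality on the open stratum -/

section NonTangential

variable {N k : ℕ} {c : ℂ}

/-- The coefficient vector of `x ^ d * (x ^ k + ∑ l, q l * x ^ l)`. -/
def shiftVec (q : Fin k → ℂ) (d : ℕ) (hd : d + k < N) : Fin N → ℂ :=
  Pi.single ⟨d + k, hd⟩ 1 + ∑ l : Fin k, q l • Pi.single ⟨d + l, by omega⟩ 1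

theorem sum_mul_shiftVec (q : Fin k → ℂ) {d : ℕ} (hd : d + k < N) (f : Fin N → ℂ) :
    ∑ m, f m * shiftVec q d hd m =
      f ⟨d + k, hd⟩ + ∑ l : Fin k, q l * f ⟨d + l, by omega⟩ := by
  simp only [shiftVec, Pi.add_apply, Finset.sum_apply, Pi.smul_apply, smul_eq_mul, mul_add,
    Finset.sum_add_distrib, Finset.mul_sum]
  rw [Finset.sum_comm]
  simp [Pi.single_apply, mul_comm]

theorem leadingCorner_eq_hankelOf (h : k ≤ N) {X : Matrix (Fin N) (Fin N) ℂ}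
    (hX : X ∈ hankelMatrices N) : leadingCorner h X = hankelOf k (hankelSeq c X) := by
  ext i j
  exact apply_eq_hankelSeq c hX _ _

theorem mulVec_shiftVec {X : Matrix (Fin N) (Fin N) ℂ} (hX : X ∈ hankelMatrices N)
    (q : Fin k → ℂ) {d : ℕ} (hd : d + k < N) (i : Fin N) :
    X.mulVec (shiftVec q d hd) i = hankelSeq c X (i + d + k) +
      ∑ l : Fin k, q l * hankelSeq c X (i + d + l) := by
  rw [Matrix.mulVec, dotProduct, sum_mul_shiftVec]
  simp only [apply_eq_hankelSeq c hX, add_assoc]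

/-- A shifted coefficient vector that is killed by the first `k` rows is killed by all rows. Shift 0
gives the recursion at all indices below `N`; this covers the first `k` rows of every other shift,
and row plus shift then reaches all remaining indices. -/
theorem mem_stratum_of_rank_le (hk : k < N) {X : Matrix (Fin N) (Fin N) ℂ}
    (hX : X ∈ hankelMatrices N) (hr : X.rank ≤ k) (hdet : (hankelOf k (hankelSeq c X)).det ≠ 0) :
    X ∈ stratum N k 0 c := by
  have hdet' : (leadingCorner hk.le X).det ≠ 0 := by rwa [leadingCorner_eq_hankelOf hk.le hX]
  let q := recCoeff k (hankelSeq c X)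
  have key : ∀ d (hd : d + k < N), (∀ i < k, hankelSeq c X (i + d + k) +
      ∑ l : Fin k, q l * hankelSeq c X (i + d + l) = 0) →
      ∀ i < N, hankelSeq c X (i + d + k) +
        ∑ l : Fin k, q l * hankelSeq c X (i + d + l) = 0 := by
    intro d hd h i hi
    rw [← mulVec_shiftVec hX q hd ⟨i, hi⟩, mulVec_eq_zero_of_leadingRows hdet' hr]
    · rfl
    · funext j
      rw [leadingRows_mulVec_apply, mulVec_shiftVec (c := c) hX q hd]
      exact h j j.2
  have h0 := key 0 (by omega) fun i hi => recCoeff_spec hdet hi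
  refine mem_stratum_of_rec hX hdet (by omega) (q := q) fun j hj => ?_
  have h1 := key (j - (j - (N - 1 - k))) (by omega)
    (fun i hi => h0 (i + (j - (j - (N - 1 - k)))) (by omega)) (j - (N - 1 - k)) (by omega)
  rwa [show j - (N - 1 - k) + (j - (j - (N - 1 - k))) = j by omega] at h1

/-- The recursion expresses each later column by the `k` preceding ones, so the first `k` columns
span. -/
theorem rank_le_of_mem_stratum (hk : k ≤ N) {X : Matrix (Fin N) (Fin N) ℂ}
    (hX : X ∈ stratum N k 0 c) : X.rank ≤ k := by
  obtain ⟨hH, -, hrec⟩ := hX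
  have hXa : ∀ i j, X i j = centralExt k (hankelSeq c X) (i + j) := fun i j => by
    rw [apply_eq_hankelSeq c hH, hrec _ (by omega)]
  have hspan : ∀ j (hj : j < N), X.col ⟨j, hj⟩ ∈
      Submodule.span ℂ (Set.range fun l : Fin k => X.col (Fin.castLE hk l)) := by
    intro j
    induction j using Nat.strong_induction_on with
    | _ j ih =>
      intro hj
      by_cases hjk : j < k
      · exact Submodule.subset_span ⟨⟨j, hjk⟩, rfl⟩
      · have h1 : X.col ⟨j, hj⟩ = -∑ l : Fin k, recCoeff k (hankelSeq c X) l •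
            X.col ⟨j - k + l, by omega⟩ := by
          funext i
          have h2 := centralExt_add (k := k) (hankelSeq c X) (i + (j - k))
          rw [show (i : ℕ) + (j - k) + k = i + j by omega] at h2
          simp only [Matrix.col_apply, Pi.neg_apply, Finset.sum_apply, Pi.smul_apply, smul_eq_mul,
            hXa, ← add_assoc]
          exact eq_neg_of_add_eq_zero_left h2
        rw [h1]
        exact Submodule.neg_mem _ (Submodule.sum_mem _ fun l _ =>
          Submodule.smul_mem _ _ (ih _ (by omega) _))
  rw [Matrix.rank_eq_finrank_span_cols]
  have hle : Submodule.span ℂ (Set.range X.col) ≤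
      Submodule.span ℂ (Set.range fun l : Fin k => X.col (Fin.castLE hk l)) := by
    rw [Submodule.span_le]
    rintro _ ⟨j, rfl⟩
    exact hspan j j.2
  exact (Submodule.finrank_mono hle).trans
    ((finrank_range_le_card _).trans_eq (Fintype.card_fin k))

/-- For `k = N` the recursion coefficients read the index `2 * N - 1`, which is no antidiagonal and
where `hankelSeq` returns `c`; `ha` matches the two. -/
theorem hankelOf_centralExt_mem_stratum (hk : k ≤ N) {a : ℕ → ℂ}
    (hdet : (hankelOf k a).det ≠ 0) (ha : k = N → a (2 * N - 1) = c) :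
    hankelOf N (centralExt k a) ∈ stratum N k 0 c := by
  have h1 : ∀ m < 2 * k, hankelSeq c (hankelOf N (centralExt k a)) m = a m := by
    intro m hm
    by_cases hmN : m + 1 < 2 * N
    · rw [hankelSeq_hankelOf _ _ hmN, centralExt_of_lt hdet hm]
    · rw [hankelSeq_of_le _ _ (by omega), ← ha (by omega)]
      congr 1
      omega
  refine ⟨hankelOf_mem _, by rwa [hankelOf_congr h1], fun m hm => ?_⟩
  rw [hankelSeq_hankelOf _ _ (by omega), centralExt_congr h1]

theorem isManifoldAt_hankelRankLE (hk : k < N) {A : Matrix (Fin N) (Fin N) ℂ}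
    (hA : A ∈ stratum N k 0 c) : IsManifoldAt (stratumDim N k 0) (hankelRankLE N k) A := by
  refine (isManifoldAt_stratum hA).congr ?_
  filter_upwards [(isOpen_leading_det_ne_zero N k c).mem_nhds hA.2.1] with X hX
  exact ⟨fun h => ⟨rank_le_of_mem_stratum hk.le h, h.1⟩,
    fun h => mem_stratum_of_rank_le hk h.2 h.1 hX⟩

theorem tangentVectors_mono {E : Type*} [NormedAddCommGroup E] [NormedSpace ℝ E] {S S' : Set E}
    (h : S ⊆ S') (A : E) : tangentVectors S A ⊆ tangentVectors S' A := by
  rintro v ⟨γ, h0, hγ, hd⟩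
  exact ⟨γ, h0, hγ.mono fun t ht => h ht, hd⟩

theorem mem_hankelMatrices_of_mem_tangentVectors {A v : Matrix (Fin N) (Fin N) ℂ}
    (hv : v ∈ tangentVectors (hankelMatrices N) A) : v ∈ hankelMatrices N := by
  obtain ⟨γ, -, hγ, hd⟩ := hv
  intro i j i' j' h
  refine (hasDerivAt_entry hd i j).unique ((hasDerivAt_entry hd i' j').congr_of_eventuallyEq ?_)
  filter_upwards [hγ] with t ht
  exact ht i j i' j' h

theorem hasDerivAt_hankelSeq {γ : ℝ → Matrix (Fin N) (Fin N) ℂ} {v : Matrix (Fin N) (Fin N) ℂ}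
    (hγ : HasDerivAt γ v 0) {m : ℕ} (hm : m + 1 < 2 * N) :
    HasDerivAt (fun t => hankelSeq c (γ t) m) (hankelSeq c v m) 0 := by
  simp only [hankelSeq, dif_pos hm]
  exact hasDerivAt_entry hγ _ _

/-- A sequence with `2 * k` vanishing initial values that satisfies the recursion with
characteristic polynomial `(x ^ k + ∑ l, q l * x ^ l) ^ 2` vanishes. -/
theorem eq_zero_of_square_rec {q : Fin k → ℂ} {b B : ℕ → ℂ} {M : ℕ}
    (hB : ∀ j, B j = b (j + k) + ∑ l : Fin k, q l * b (j + l))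
    (h : ∀ j, j + 2 * k < M → B (j + k) + ∑ l : Fin k, q l * B (j + l) = 0)
    (h0 : ∀ j < 2 * k, b j = 0) : ∀ j < M, b j = 0 := by
  intro j
  induction j using Nat.strong_induction_on with
  | _ j ih =>
    intro hj
    by_cases hjk : j < 2 * k
    · exact h0 j hjk
    · obtain ⟨i, rfl⟩ : ∃ i, j = i + 2 * k := ⟨j - 2 * k, by omega⟩
      have hB0 : ∀ m < i + k, B m = 0 := by
        intro m hm
        rw [hB, ih _ (by omega) (by omega), zero_add]
        exact Finset.sum_eq_zero fun l _ => by rw [ih _ (by omega) (by omega), mul_zero]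
      have h1 := h i hj
      rw [Finset.sum_eq_zero (fun l _ => by rw [hB0 _ (by omega), mul_zero]), add_zero, hB,
        Finset.sum_eq_zero (fun l _ => by rw [ih _ (by omega) (by omega), mul_zero]), add_zero]
        at h1
      rwa [two_mul, ← add_assoc]

/-- As `A` is symmetric, the shifted coefficient vectors are null vectors on both sides. Pairing the
Hankel matrix `v - y` with the shifts `d` and `d'` applies the recursion twice to its sequence at
index `d + d'`, and `eq_zero_of_square_rec` applies. -/
theorem eq_of_mem_tangentVectors (hk : k < N) {A v y : Matrix (Fin N) (Fin N) ℂ}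
    (hA : A ∈ stratum N k 0 0)
    (hv : v ∈ tangentVectors (rankLE N k) A) (hvH : v ∈ hankelMatrices N)
    (hy : y ∈ tangentVectors (rankLE N k) A) (hyH : y ∈ hankelMatrices N)
    (heq : ∀ m < 2 * k, hankelSeq 0 v m = hankelSeq 0 y m) : v = y := by
  have hdet : (leadingCorner hk.le A).det ≠ 0 := by
    rw [leadingCorner_eq_hankelOf hk.le hA.1]
    exact hA.2.1
  obtain ⟨q, hq⟩ : ∃ q, q = recCoeff k (hankelSeq 0 A) := ⟨_, rfl⟩
  have hnull : ∀ d (hd : d + k < N), A.mulVec (shiftVec q d hd) = 0 := by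
    intro d hd
    funext i
    rw [mulVec_shiftVec (c := 0) hA.1 q hd, hA.2.2 _ (by omega), hq,
      Finset.sum_congr rfl fun l _ => by rw [hA.2.2 (i + d + l) (by omega)]]
    exact centralExt_add _ _
  have hsymm : A.transpose = A := by
    ext i j
    exact hA.1 j i i j (add_comm _ _)
  have hnull' : ∀ d (hd : d + k < N), A.vecMul (shiftVec q d hd) = 0 := by
    intro d hd
    rw [← Matrix.mulVec_transpose, hsymm, hnull d hd]
  have hzH : v - y ∈ hankelMatrices N := (hankelSubmodule N).sub_mem hvH hyH
  have hbil : ∀ d d' (hd : d + k < N) (hd' : d' + k < N),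
      ∑ i, ∑ j, shiftVec q d hd i * (v - y) i j * shiftVec q d' hd' j = 0 := by
    intro d d' hd hd'
    simp only [Matrix.sub_apply, mul_sub, sub_mul, Finset.sum_sub_distrib]
    rw [bilin_eq_zero_of_mem_tangentVectors hk.le hdet hv (hnull' d hd) (hnull d' hd'),
      bilin_eq_zero_of_mem_tangentVectors hk.le hdet hy (hnull' d hd) (hnull d' hd'), sub_zero]
  obtain ⟨b, hb⟩ : ∃ b, b = hankelSeq 0 (v - y) := ⟨_, rfl⟩
  obtain ⟨B, hB⟩ : ∃ B : ℕ → ℂ, ∀ j, B j = b (j + k) + ∑ l : Fin k, q l * b (j + l) :=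
    ⟨_, fun _ => rfl⟩
  have hBrec : ∀ d d', d + k < N → d' + k < N →
      B (d + d' + k) + ∑ l : Fin k, q l * B (d + d' + l) = 0 := by
    intro d d' hd hd'
    have h1 := hbil d d' hd hd'
    have h2 : ∀ i : Fin N, ∑ j, shiftVec q d hd i * (v - y) i j * shiftVec q d' hd' j =
        B (d' + i) * shiftVec q d hd i := by
      intro i
      have h3 := mulVec_shiftVec (c := 0) hzH q hd' i
      rw [Matrix.mulVec, dotProduct, ← hb, add_comm (i : ℕ) d', ← hB] at h3
      rw [← h3, Finset.sum_mul]
      exact Finset.sum_congr rfl fun j _ => by ring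
    simp only [h2] at h1
    rw [sum_mul_shiftVec q hd fun i : Fin N => B (d' + i)] at h1
    simp only [← add_assoc] at h1
    rwa [add_comm d d']
  -- `j + 2 * k < 2 * N - 1` means `j ≤ 2 * (N - 1 - k)`, so `j` is a sum of two admissible shifts.
  have hb0 := eq_zero_of_square_rec (M := 2 * N - 1) hB (fun j hj => by
      have h1 := hBrec (min j (N - 1 - k)) (j - min j (N - 1 - k)) (by omega) (by omega)
      rwa [show min j (N - 1 - k) + (j - min j (N - 1 - k)) = j by omega] at h1)
    (fun j hj => by rw [hb, hankelSeq_sub _ _ _ (by omega), heq j hj, sub_self])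
  rw [← sub_eq_zero]
  ext i j
  rw [apply_eq_hankelSeq 0 hzH, ← hb]
  exact hb0 _ (by omega)

/-- A tangent vector of the Hankel matrices is, on the first `2 * k` antidiagonals, the velocity of
a curve of Hankel matrices of rank at most `k`. -/
theorem exists_mem_tangentVectors (hk : k < N) {A : Matrix (Fin N) (Fin N) ℂ}
    (hA : A ∈ stratum N k 0 0) (v : Matrix (Fin N) (Fin N) ℂ) :
    ∃ y ∈ tangentVectors (hankelRankLE N k) A,
      ∀ m < 2 * k, hankelSeq 0 v m = hankelSeq 0 y m := by
  let U : Set (Matrix (Fin N) (Fin N) ℂ) := {X | (hankelOf k (hankelSeq 0 X)).det ≠ 0}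
  have hU : IsOpen U := isOpen_leading_det_ne_zero N k 0
  -- `G` keeps the first `2 * k` antidiagonals and continues them by their recursion. It fixes `A`,
  -- so it carries the line `A + t • v` to the desired curve.
  obtain ⟨G, hGX⟩ : ∃ G : Matrix (Fin N) (Fin N) ℂ → Matrix (Fin N) (Fin N) ℂ,
      ∀ X, G X = hankelOf N (centralExt k (hankelSeq 0 X)) := ⟨_, fun _ => rfl⟩
  have hG : ContDiffOn ℝ ∞ G U := contDiffOn_matrix fun i j => by
    simp only [hGX, hankelOf_apply]
    exact contDiffOn_centralExt (fun m => (contDiff_hankelSeq 0 m).contDiffOn) (fun X hX => hX) _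
  have hline : HasDerivAt (fun t : ℝ => A + t • v) v 0 := by
    have h1 := ((hasDerivAt_id (0 : ℝ)).smul_const v).const_add A
    rw [one_smul] at h1
    exact h1
  have h0 : A + (0 : ℝ) • v = A := by simp
  have hGA : DifferentiableAt ℝ G (A + (0 : ℝ) • v) := by
    rw [h0]
    exact (hG.contDiffAt (hU.mem_nhds hA.2.1)).differentiableAt (by simp)
  have hγ : HasDerivAt (fun t : ℝ => G (A + t • v)) (fderiv ℝ G (A + (0 : ℝ) • v) v) 0 :=
    hGA.hasFDerivAt.comp_hasDerivAt (0 : ℝ) hline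
  have hev : ∀ᶠ t : ℝ in 𝓝 0, A + t • v ∈ U :=
    hline.continuousAt.eventually (hU.mem_nhds (h0.symm ▸ hA.2.1 : A + (0 : ℝ) • v ∈ U))
  refine ⟨_, ⟨_, ?_, ?_, hγ⟩, fun m hm => ?_⟩
  · rw [h0, hGX]
    ext i j
    rw [hankelOf_apply, ← hA.2.2 _ (by omega), ← apply_eq_hankelSeq 0 hA.1]
  · filter_upwards [hev] with t ht
    have h1 := hankelOf_centralExt_mem_stratum hk.le (c := 0) ht (by omega)
    rw [hGX]
    exact ⟨rank_le_of_mem_stratum hk.le h1, h1.1⟩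
  · refine (hasDerivAt_hankelSeq hline (c := 0) (by omega)).unique
      ((hasDerivAt_hankelSeq hγ (c := 0) (by omega)).congr_of_eventuallyEq ?_)
    filter_upwards [hev] with t ht
    rw [hGX, hankelSeq_hankelOf _ _ (by omega), centralExt_of_lt ht hm]

theorem isNonTangential_of_mem_stratum (hk : k < N) {A : Matrix (Fin N) (Fin N) ℂ}
    (hA : A ∈ stratum N k 0 0) : IsNonTangential (rankLE N k) (hankelMatrices N) A := by
  have hdet : (leadingCorner hk.le A).det ≠ 0 := by
    rw [leadingCorner_eq_hankelOf hk.le hA.1]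
    exact hA.2.1
  refine ⟨⟨isManifoldAt_rankLE hk.le hdet (rank_le_of_mem_stratum hk.le hA),
    ⟨_, isManifoldAt_submodule (hankelSubmodule N) hA.1⟩, ⟨_, isManifoldAt_hankelRankLE hk hA⟩⟩,
    Subset.antisymm ?_ (subset_inter (tangentVectors_mono inter_subset_left A)
      (tangentVectors_mono inter_subset_right A))⟩
  rintro v ⟨hvR, hvH⟩
  obtain ⟨y, hy, heq⟩ := exists_mem_tangentVectors hk hA v
  rw [eq_of_mem_tangentVectors hk hA hvR (mem_hankelMatrices_of_mem_tangentVectors hvH)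
    (tangentVectors_mono inter_subset_left A hy)
    (mem_hankelMatrices_of_mem_tangentVectors (tangentVectors_mono inter_subset_right A hy)) heq]
  exact hy

end NonTangential

/-! ### Density of the open stratum -/

section Density

variable {N k : ℕ}

theorem det_hankelOf_antidiagonal {R : Type*} [CommRing R] [Nontrivial R] (k : ℕ) :
    (hankelOf k fun m => if m + 1 = k then (1 : R) else 0).det ≠ 0 := by
  have h1 : (hankelOf k fun m => if m + 1 = k then (1 : R) else 0) *
      (hankelOf k fun m => if m + 1 = k then (1 : R) else 0) = 1 := by
    ext i j
    rw [Matrix.mul_apply, Finset.sum_eq_single ⟨k - 1 - i, by omega⟩]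
    · simp only [hankelOf_apply, Matrix.one_apply, Fin.ext_iff]
      rw [if_pos (by omega), one_mul]
      exact if_congr (by omega) rfl rfl
    · intro l _ hl
      rw [hankelOf_apply, if_neg, zero_mul]
      intro h
      exact hl (Fin.ext (by simp only; omega))
    · simp
  intro h0
  have h2 := congrArg Matrix.det h1
  rw [Matrix.det_mul, h0, zero_mul, Matrix.det_one] at h2
  exact zero_ne_one h2

open Polynomial in
/-- Every Hankel matrix with a recursion of order `k` is a limit of such matrices whose leading
minor of order `k` does not vanish. -/
theorem hankelOf_recExt_mem_closure (hk : k < N) (q : Fin k → ℂ) (a : ℕ → ℂ) :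
    hankelOf N (recExt q a) ∈ closure (stratum N k 0 0) := by
  -- A path from the given data at 0 to the zero recursion with initial values `0, …, 0, 1` at 1.
  -- There the corner is the exchange matrix, so the minor `D` is a nonzero polynomial and vanishes
  -- at only finitely many parameters.
  let q' : Fin k → ℂ[X] := fun l => C (q l) * (1 - X)
  let a' : ℕ → ℂ[X] := fun m => C (a m) * (1 - X) + (if m + 1 = k then 1 else 0) * X
  let D : ℂ[X] := (hankelOf k (recExt q' a')).det
  have heval : ∀ (t : ℂ) (m : ℕ), (recExt q' a' m).eval t =
      recExt (fun l => (q' l).eval t) (fun i => (a' i).eval t) m := fun t m =>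
    map_recExt (evalRingHom t) q' a' m
  have hDeval : ∀ t : ℂ, D.eval t = (hankelOf k fun m => (recExt q' a' m).eval t).det := fun t =>
    (evalRingHom t).map_det _
  have hD : D ≠ 0 := by
    intro h0
    have h1 := hDeval 1
    rw [h0, eval_zero] at h1
    have h2 : (fun m => (recExt q' a' m).eval 1) = fun m => if m + 1 = k then (1 : ℂ) else 0 := by
      funext m
      rw [heval]
      by_cases hm : m < k
      · rw [recExt_of_lt _ _ hm]
        by_cases hmk : m + 1 = k <;> simp [a', hmk]
      · obtain ⟨j, rfl⟩ : ∃ j, m = j + k := ⟨m - k, by omega⟩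
        have h3 := recExt_add (fun l => (q' l).eval 1) (fun i => (a' i).eval 1) j
        rw [eq_neg_of_add_eq_zero_left h3, if_neg (by omega)]
        simp [q']
    rw [h2] at h1
    exact det_hankelOf_antidiagonal k h1.symm
  have hS : Dense {t : ℂ | D.IsRoot t}ᶜ :=
    (finite_setOfPred_isRoot hD).countable.dense_compl ℂ
  have : (𝓝[{t : ℂ | D.IsRoot t}ᶜ] 0).NeBot := mem_closure_iff_nhdsWithin_neBot.1 (hS 0)
  have htend : Tendsto (fun t : ℂ => hankelOf N fun m => (recExt q' a' m).eval t)
      (𝓝[{t : ℂ | D.IsRoot t}ᶜ] 0) (𝓝 (hankelOf N (recExt q a))) := by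
    refine tendsto_matrix fun i j => ?_
    have h1 : hankelOf N (recExt q a) i j = (recExt q' a' (i + j)).eval 0 := by
      rw [heval, hankelOf_apply]
      congr 1
      · simp [q']
      · funext m
        by_cases hm : m + 1 = k <;> simp [a', hm]
    rw [h1]
    exact ((recExt q' a' (i + j)).continuous.tendsto 0).mono_left nhdsWithin_le_nhds
  refine mem_closure_of_tendsto htend ?_
  filter_upwards [self_mem_nhdsWithin] with t ht
  have h1 : ∀ m < 2 * k, hankelSeq 0 (hankelOf N fun m => (recExt q' a' m).eval t) m =
      (recExt q' a' m).eval t := fun m hm => hankelSeq_hankelOf _ _ (by omega)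
  refine mem_stratum_of_rec (hankelOf_mem _) ?_ (by omega) (q := fun l => (q' l).eval t) ?_
  · rw [hankelOf_congr h1, ← hDeval]
    exact ht
  · intro j hj
    rw [hankelSeq_hankelOf _ _ (by omega)]
    rw [Finset.sum_congr rfl fun l _ => by rw [hankelSeq_hankelOf _ _ (by omega)]]
    simp only [heval]
    exact recExt_add _ _ j

/-- A recursion of order at most `k` for the first terms of a sequence can be perturbed to
recursions of order `k`. -/
theorem exists_perturbation {n p : ℕ} {a Q : ℕ → ℂ} (hp : p ≤ k) (hQp : Q p = 1)
    (hQ : ∀ l, p < l → Q l = 0)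
    (ha : ∀ j < n, ∑ l ∈ Finset.range (k + 1), Q l * a (j + l) = 0) :
    ∃ b : ℂ → ℕ → ℂ, (∀ m, Tendsto (fun ε => b ε m) (𝓝 0) (𝓝 (a m))) ∧ ∀ᶠ ε in 𝓝 (0 : ℂ),
      ∀ j < n, ∑ l ∈ Finset.range (k + 1), (Q l + if l = k then ε else 0) * b ε (j + l) = 0 := by
  let Q' : ℂ → ℕ → ℂ := fun ε l => Q l + if l = k then ε else 0
  have hQ' : ∀ l, ContDiff ℝ ∞ fun ε => Q' ε l := by
    intro l
    by_cases hl : l = k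
    · simp only [Q', if_pos hl]
      exact contDiff_const.add (contDiff_id (𝕜 := ℝ) (E := ℂ))
    · simpa only [Q', if_neg hl] using contDiff_const.add contDiff_const
  -- The sequence is corrected only at the positions `p, …, p + n - 1`, and `W ε` is the matrix of
  -- the resulting linear system. At `ε = 0` it is lower unitriangular and the right-hand side
  -- vanishes, so the correction exists near 0 and tends to 0.
  let W : ℂ → Matrix (Fin n) (Fin n) ℂ := fun ε => Matrix.of fun j i =>
    ∑ l ∈ Finset.range (k + 1), Q' ε l * if (j : ℕ) + l = p + i then 1 else 0
  have hW : ∀ i j, ContDiff ℝ ∞ fun ε => W ε i j := fun i j => by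
    simp only [W, Matrix.of_apply]
    exact ContDiff.sum fun l _ => (hQ' l).mul contDiff_const
  let r : ℂ → Fin n → ℂ := fun ε j => ∑ l ∈ Finset.range (k + 1), Q' ε l * a (j + l)
  have hr : ∀ j, ContDiff ℝ ∞ fun ε => r ε j := fun j =>
    ContDiff.sum fun l _ => (hQ' l).mul contDiff_const
  have hQ0 : ∀ l, Q' 0 l = Q l := fun l => by simp [Q']
  have hr0 : r 0 = 0 := funext fun j => by
    simp only [r, hQ0]
    exact ha j j.2
  have hW0 : (W 0).det = 1 := by
    rw [Matrix.det_of_isLowerTriangular]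
    · refine Finset.prod_eq_one fun i _ => ?_
      simp only [W, Matrix.of_apply, hQ0]
      rw [Finset.sum_eq_single p, if_pos (add_comm _ _), hQp, one_mul]
      · intro l _ hl
        rw [if_neg (by omega), mul_zero]
      · intro h
        rw [Finset.mem_range] at h
        omega
    · intro j i hij
      have hij' : (j : ℕ) < i := hij
      simp only [W, Matrix.of_apply, hQ0]
      refine Finset.sum_eq_zero fun l _ => ?_
      by_cases hl : p < l
      · rw [hQ l hl, zero_mul]
      · rw [if_neg (by omega), mul_zero]
  let S : Set ℂ := {ε | (W ε).det ≠ 0}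
  have hS : S ∈ 𝓝 (0 : ℂ) := by
    have h1 : ContDiffOn ℝ ∞ (fun ε => (W ε).det) univ :=
      contDiffOn_det fun i j => (hW i j).contDiffOn
    exact (isOpen_ne.preimage (continuousOn_univ.1 h1.continuousOn)).mem_nhds (by simp [hW0])
  let x : ℂ → Fin n → ℂ := fun ε => (W ε)⁻¹.mulVec (r ε)
  have hx : ∀ i, Tendsto (fun ε => x ε i) (𝓝 0) (𝓝 0) := by
    intro i
    have h1 : ContDiffOn ℝ ∞ (fun ε => x ε i) S := by
      simp only [x, Matrix.mulVec, dotProduct]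
      exact ContDiffOn.sum fun j _ => (contDiffOn_inv_apply (fun i j => (hW i j).contDiffOn)
        (fun ε hε => hε) i j).mul (hr j).contDiffOn
    have h2 := (h1.continuousOn.continuousAt hS).tendsto
    simpa [x, hr0] using h2
  refine ⟨fun ε m => a m - ∑ i : Fin n, if m = p + i then x ε i else 0, fun m => ?_, ?_⟩
  · have h1 : Tendsto (fun ε => ∑ i : Fin n, if m = p + i then x ε i else 0) (𝓝 0)
        (𝓝 (∑ i : Fin n, 0)) := by
      refine tendsto_finsetSum _ fun i _ => ?_
      split_ifs
      · exact hx i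
      · exact tendsto_const_nhds
    simpa using tendsto_const_nhds.sub h1
  · filter_upwards [hS] with ε hε j hj
    have h1 : (W ε).mulVec (x ε) ⟨j, hj⟩ = r ε ⟨j, hj⟩ := by
      rw [Matrix.mulVec_mulVec, Matrix.mul_nonsing_inv _ (isUnit_iff_ne_zero.2 hε),
        Matrix.one_mulVec]
    have h2 : (W ε).mulVec (x ε) ⟨j, hj⟩ = ∑ l ∈ Finset.range (k + 1),
        Q' ε l * ∑ i : Fin n, if j + l = p + i then x ε i else 0 := by
      simp only [Matrix.mulVec, dotProduct, W, Matrix.of_apply, Finset.sum_mul, Finset.mul_sum]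
      rw [Finset.sum_comm]
      refine Finset.sum_congr rfl fun l _ => Finset.sum_congr rfl fun i _ => ?_
      split_ifs <;> simp
    change ∑ l ∈ Finset.range (k + 1), Q' ε l * _ = 0
    simp only [mul_sub, Finset.sum_sub_distrib]
    rw [← h2, h1, sub_eq_zero]

/-- As `p + s ≤ k`, a recursion of order `p` that fails only on the last `s` antidiagonals is a
degenerate relation of order `k` valid everywhere. Adding `ε` to its coefficient at `k` makes the
order genuinely `k`; a second limit makes the leading minor nonzero. -/
theorem hankelRankLE_subset_closure (hk : k < N) :
    hankelRankLE N k ⊆ closure (stratum N k 0 0) := by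
  rintro X ⟨hr, hX⟩
  obtain ⟨p, s, hps, -, hdet, hrec⟩ := exists_mem_stratum hX hr hk
  obtain ⟨a, ha⟩ : ∃ a, a = hankelSeq 0 X := ⟨_, rfl⟩
  rw [← ha] at hdet hrec
  let Q : ℕ → ℂ := fun l => if h : l < p then recCoeff p a ⟨l, h⟩ else if l = p then 1 else 0
  have hQ : ∀ j < 2 * N - 1 - k, ∑ l ∈ Finset.range (k + 1), Q l * a (j + l) = 0 := by
    intro j hj
    have h1 : ∑ l ∈ Finset.range (k + 1), Q l * a (j + l) =
        ∑ l ∈ Finset.range (p + 1), Q l * a (j + l) := by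
      refine (Finset.sum_subset (Finset.range_mono (by omega)) fun l _ hl => ?_).symm
      rw [Finset.mem_range] at hl
      simp only [Q]
      rw [dif_neg (by omega), if_neg (by omega), zero_mul]
    rw [h1, Finset.sum_range_succ, ← Fin.sum_univ_eq_sum_range (fun l => Q l * a (j + l)), add_comm]
    simp only [Q, lt_irrefl, dite_false, if_true, one_mul, Fin.is_lt, dite_true, Fin.eta]
    rw [hrec (j + p) (by omega),
      Finset.sum_congr rfl fun l _ => by rw [hrec (j + l) (by omega)]]
    exact centralExt_add a j
  obtain ⟨b, hb, hrecb⟩ := exists_perturbation (p := p) (by omega) (by simp [Q])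
    (fun l hl => by simp only [Q]; rw [dif_neg (by omega), if_neg (by omega)]) hQ
  have htend : Tendsto (fun ε => hankelOf N (b ε)) (𝓝[≠] 0) (𝓝 X) := by
    refine tendsto_matrix fun i j => ?_
    rw [apply_eq_hankelSeq 0 hX, ← ha]
    exact (hb _).mono_left nhdsWithin_le_nhds
  rw [← closure_closure]
  refine mem_closure_of_tendsto htend ?_
  -- If `p = k` the leading coefficient is near 1; otherwise it equals `ε`, whence the punctured
  -- neighbourhood.
  have hlead : ∀ᶠ ε in 𝓝[≠] (0 : ℂ), Q k + ε ≠ 0 := by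
    by_cases hpk : p = k
    · have h1 : ∀ᶠ ε in 𝓝 (0 : ℂ), Q k + ε ≠ 0 :=
        (continuous_const.add continuous_id).continuousAt.eventually_ne (by simp [hpk])
      exact h1.filter_mono nhdsWithin_le_nhds
    · have h1 : Q k = 0 := by
        simp only [Q]
        rw [dif_neg (by omega), if_neg (by omega)]
      filter_upwards [self_mem_nhdsWithin] with ε hε
      simpa [h1] using hε
  filter_upwards [hrecb.filter_mono nhdsWithin_le_nhds, hlead] with ε hε hl
  have h1 : hankelOf N (b ε) = hankelOf N (recExt (fun l : Fin k => Q l / (Q k + ε)) (b ε)) := by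
    ext i j
    rw [hankelOf_apply, hankelOf_apply]
    refine (recExt_eq_of_rec (M := 2 * N - 1) (fun j hj => ?_) (by omega)).symm
    have h2 := hε j (by omega)
    rw [Finset.sum_range_succ, if_pos rfl, ← Fin.sum_univ_eq_sum_range
      (fun l => (Q l + if l = k then ε else 0) * b ε (j + l)),
      Finset.sum_congr rfl fun l _ => by rw [if_neg (by omega), add_zero]] at h2
    have h3 : ∑ l : Fin k, Q l / (Q k + ε) * b ε (j + l) =
        (∑ l : Fin k, Q l * b ε (j + l)) / (Q k + ε) := by
      rw [Finset.sum_div]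
      exact Finset.sum_congr rfl fun l _ => by ring
    rw [h3, eq_neg_of_add_eq_zero_left h2]
    field_simp
    ring
  rw [h1]
  exact hankelOf_recExt_mem_closure hk _ _

end Density

/-! ### The generic class is open in its stratum -/

section Generic

variable {N k : ℕ}

open Polynomial in
/-- The polynomial `x ^ k + ∑ l, q l * x ^ l`. -/
noncomputable def recPoly (q : Fin k → ℂ) : ℂ[X] := X ^ k + ∑ l : Fin k, C (q l) * X ^ (l : ℕ)

theorem recPoly_monic (q : Fin k → ℂ) : (recPoly q).Monic :=
  Polynomial.monic_X_pow_add (Polynomial.degree_sum_fin_lt q)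

theorem natDegree_recPoly (q : Fin k → ℂ) : (recPoly q).natDegree = k :=
  Polynomial.natDegree_eq_of_degree_eq_some ((Polynomial.degree_add_eq_left_of_degree_lt (by
    rw [Polynomial.degree_X_pow]
    exact Polynomial.degree_sum_fin_lt q)).trans (Polynomial.degree_X_pow k))

theorem coeff_recPoly (q : Fin k → ℂ) (m : ℕ) :
    (recPoly q).coeff m = (if m = k then 1 else 0) + ∑ l : Fin k, if m = l then q l else 0 := by
  simp [recPoly, Polynomial.coeff_X_pow]

theorem coeff_recPoly_fin (q : Fin k → ℂ) (l : Fin k) : (recPoly q).coeff l = q l := by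
  rw [coeff_recPoly, if_neg (by omega)]
  simp [← Fin.ext_iff]

theorem eq_recPoly {P : Polynomial ℂ} (hP : P.Monic) (hk : P.natDegree = k) :
    P = recPoly fun l : Fin k => P.coeff l := by
  refine Polynomial.ext fun m => ?_
  rcases lt_trichotomy m k with h | rfl | h
  · exact (coeff_recPoly_fin (fun l : Fin k => P.coeff l) ⟨m, h⟩).symm
  · have h1 := (recPoly_monic fun l : Fin m => P.coeff l).coeff_natDegree
    rw [natDegree_recPoly] at h1
    rw [h1, ← hP.coeff_natDegree, hk]
  · rw [Polynomial.coeff_eq_zero_of_natDegree_lt (by omega),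
      Polynomial.coeff_eq_zero_of_natDegree_lt (by rwa [natDegree_recPoly])]

theorem sum_coeff_recPoly (q : Fin k → ℂ) (f : ℕ → ℂ) (j : ℕ) :
    ∑ l ∈ Finset.range (k + 1), (recPoly q).coeff l * f (j + l) =
      f (j + k) + ∑ l : Fin k, q l * f (j + l) := by
  have h1 := (recPoly_monic q).coeff_natDegree
  rw [natDegree_recPoly] at h1
  rw [Finset.sum_range_succ, ← Fin.sum_univ_eq_sum_range (fun l => (recPoly q).coeff l * f (j + l)),
    h1, one_mul, add_comm]
  simp only [coeff_recPoly_fin]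

/-- The coefficients of the polynomials with only simple zeros, none of them `0`. -/
def simpleZeros (k : ℕ) : Set (Fin k → ℂ) :=
  {q | (recPoly q).coeff 0 ≠ 0 ∧ (recPoly q).roots.Nodup}

/-- Simplicity of the zeros is the nonvanishing of the resultant of the polynomial and its
derivative, a determinant of fixed size with entries continuous in the coefficients. -/
theorem isOpen_simpleZeros (k : ℕ) : IsOpen (simpleZeros k) := by
  have hcoeff : ∀ m, Continuous fun q : Fin k → ℂ => (recPoly q).coeff m := by
    intro m
    simp only [coeff_recPoly]
    refine continuous_const.add (continuous_finsetSum _ fun l _ => ?_)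
    split_ifs
    · exact continuous_apply l
    · exact continuous_const
  have hdisc : Continuous fun q : Fin k → ℂ =>
      (recPoly q).resultant (recPoly q).derivative k (k - 1) := by
    simp only [Polynomial.resultant]
    refine Continuous.matrix_det (continuous_matrix fun i j => ?_)
    simp only [Polynomial.sylvester, Matrix.of_apply, Polynomial.coeff_derivative]
    refine Fin.addCases (fun j => ?_) (fun j => ?_) j
    · simp only [Fin.addCases_left]
      split_ifs
      · exact (hcoeff _).mul continuous_const
      · exact continuous_const
    · simp only [Fin.addCases_right]
      split_ifs
      · exact hcoeff _
      · exact continuous_const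
  have heq : simpleZeros k = {q | (recPoly q).coeff 0 ≠ 0} ∩
      {q | (recPoly q).resultant (recPoly q).derivative k (k - 1) ≠ 0} := by
    ext q
    refine and_congr Iff.rfl ?_
    have h1 : (recPoly q).resultant (recPoly q).derivative k (k - 1) =
        (recPoly q).resultant (recPoly q).derivative := by
      rw [Polynomial.natDegree_derivative, natDegree_recPoly]
    have h0 := (recPoly_monic q).ne_zero
    rw [mem_ofPred_eq, h1, Ne, Polynomial.resultant_eq_zero_iff,
      Polynomial.nodup_roots_iff_of_splits h0 (IsAlgClosed.splits _), Polynomial.Separable]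
    simp [h0]
  rw [heq]
  exact (isOpen_ne.preimage (hcoeff 0)).inter (isOpen_ne.preimage hdisc)

theorem mem_stratum_of_rank_le' (hk : k ≤ N) {c : ℂ} {X : Matrix (Fin N) (Fin N) ℂ}
    (hX : X ∈ hankelMatrices N) (hr : X.rank ≤ k) (hdet : (hankelOf k (hankelSeq c X)).det ≠ 0) :
    X ∈ stratum N k 0 c := by
  rcases hk.lt_or_eq with hlt | rfl
  · exact mem_stratum_of_rank_le hlt hX hr hdet
  · exact ⟨hX, hdet, fun m hm => (centralExt_of_lt hdet (by omega)).symm⟩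

theorem genericHankel_subset_stratum (hk : k ≤ N) (c : ℂ) :
    genericHankel N k ⊆ stratum N k 0 c := by
  rintro A ⟨⟨hr, hA⟩, ⟨h, hdet⟩, -⟩
  refine mem_stratum_of_rank_le' hk hA hr ?_
  rw [← leadingCorner_eq_hankelOf h hA]
  exact hdet

theorem mem_genericHankel_of_mem_stratum (hk : k ≤ N) {c : ℂ} {X : Matrix (Fin N) (Fin N) ℂ}
    (hX : X ∈ stratum N k 0 c) (hq : recCoeff k (hankelSeq c X) ∈ simpleZeros k) :
    X ∈ genericHankel N k := by
  refine ⟨⟨rank_le_of_mem_stratum hk hX, hX.1⟩, ⟨hk, ?_⟩, recPoly (recCoeff k (hankelSeq c X)),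
    ⟨recPoly_monic _, natDegree_recPoly _, centralExt k (hankelSeq c X), fun i j => ?_,
      fun j => ?_⟩, hq.1, hq.2⟩
  · have h1 := leadingCorner_eq_hankelOf (c := c) hk hX.1
    rw [leadingCorner] at h1
    rw [h1]
    exact hX.2.1
  · rw [apply_eq_hankelSeq c hX.1, hX.2.2 _ (by omega)]
  · rw [sum_coeff_recPoly]
    exact centralExt_add _ j

/-- The recursion coefficients depend continuously on the matrix, so having simple nonzero zeros
persists on the stratum near `A`. -/
theorem isManifoldAt_genericHankel (hk : k ≤ N) {A : Matrix (Fin N) (Fin N) ℂ}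
    (hA : A ∈ genericHankel N k) : IsManifoldAt (stratumDim N k 0) (genericHankel N k) A := by
  obtain ⟨P, ⟨hP, hPk, f, hf, hrec⟩, hP0, hPn⟩ := hA.2.2
  -- For `k = N` the antidiagonals leave the recursion undetermined. This value of the missing term
  -- makes `P` the polynomial computed at `A`.
  let c : ℂ := f (2 * N - 1)
  have hAs := genericHankel_subset_stratum hk c hA
  have hseq : ∀ m < 2 * k, hankelSeq c A m = f m := by
    intro m hm
    by_cases hmN : m + 1 < 2 * N
    · rw [show A = hankelOf N f from Matrix.ext hf, hankelSeq_hankelOf _ _ hmN]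
    · rw [hankelSeq_of_le _ _ (by omega)]
      change f _ = f _
      congr 1
      omega
  have hPq := eq_recPoly hP hPk
  have hq : recCoeff k (hankelSeq c A) = fun l : Fin k => P.coeff l := by
    refine (eq_recCoeff hAs.2.1 fun i hi => ?_).symm
    have h1 := hrec i
    rw [hPq, sum_coeff_recPoly] at h1
    rw [hseq _ (by omega), ← h1]
    congr 1
    exact Finset.sum_congr rfl fun l _ => by rw [hseq _ (by omega)]
  have hgood : recCoeff k (hankelSeq c A) ∈ simpleZeros k := by
    rw [hq, simpleZeros, mem_ofPred_eq, ← hPq]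
    exact ⟨hP0, hPn⟩
  have hcont : ContinuousAt (fun X => recCoeff k (hankelSeq c X)) A := by
    refine continuousAt_pi.2 fun l => ?_
    exact (contDiffOn_recCoeff (s := {X | (hankelOf k (hankelSeq c X)).det ≠ 0})
      (fun m => (contDiff_hankelSeq c m).contDiffOn) (fun X hX => hX) l).continuousOn.continuousAt
        ((isOpen_leading_det_ne_zero N k c).mem_nhds hAs.2.1)
  refine (isManifoldAt_stratum hAs).congr ?_
  filter_upwards [hcont.eventually ((isOpen_simpleZeros k).mem_nhds hgood)] with X hX
  exact ⟨fun h => mem_genericHankel_of_mem_stratum hk h hX,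
    fun h => genericHankel_subset_stratum hk c h⟩

end Generic

/-! ### Thinness of the tangential points -/

section Thinness

variable {N k : ℕ}

theorem isNonTangential_univ {E : Type*} [NormedAddCommGroup E] [NormedSpace ℝ E]
    (F : Submodule ℝ E) {A : E} (hA : A ∈ F) : IsNonTangential univ (F : Set E) A := by
  have h1 : tangentVectors univ A = univ := by
    refine eq_univ_of_forall fun v => ⟨fun t => A + t • v, by simp, by simp, ?_⟩
    have h1 := ((hasDerivAt_id (0 : ℝ)).smul_const v).const_add A
    rw [one_smul] at h1
    exact h1
  refine ⟨⟨⟨_, isManifoldAt_submodule ⊤ (Submodule.mem_top (x := A))⟩,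
    ⟨_, isManifoldAt_submodule F hA⟩, ?_⟩, ?_⟩
  · rw [univ_inter]
    exact ⟨_, isManifoldAt_submodule F hA⟩
  · rw [h1, univ_inter, univ_inter]

theorem rankLE_self (N : ℕ) : rankLE N N = univ :=
  eq_univ_of_forall fun X => (Matrix.rank_le_card_width X).trans_eq (Fintype.card_fin N)

theorem isNonTangential_of_mem_genericHankel (hk : k ≤ N) {A : Matrix (Fin N) (Fin N) ℂ}
    (hA : A ∈ genericHankel N k) : IsNonTangential (rankLE N k) (hankelMatrices N) A := by
  rcases hk.lt_or_eq with hlt | rfl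
  · exact isNonTangential_of_mem_stratum hlt (genericHankel_subset_stratum hk 0 hA)
  · rw [rankLE_self]
    exact isNonTangential_univ (hankelSubmodule k) hA.1.2

theorem hasManifoldDim_hankelRankLE (hk : k < N) :
    HasManifoldDim (stratumDim N k 0) (hankelRankLE N k) :=
  (hankelRankLE_subset_closure hk).trans
    (closure_mono fun _ hA => isManifoldAt_hankelRankLE hk hA)

theorem isThinIn_tangentialPoints (hk : k < N) :
    IsThinIn (tangentialPoints N k) (hankelRankLE N k) := by
  let ι := {x : Fin (k + 1) × Fin (k + 1) // (x.1 : ℕ) + x.2 ≤ k ∧ ¬((x.1 : ℕ) = k ∧ (x.2 : ℕ) = 0)}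
  refine isThinIn_of_finite (ι := ι) (hasManifoldDim_hankelRankLE hk)
    (fun x => stratum N x.1.1 x.1.2 0) (fun x => stratumDim N x.1.1 x.1.2) ?_ ?_
  · rintro ⟨⟨p, s⟩, hps, hne⟩
    refine ⟨?_, fun A hA => isManifoldAt_stratum hA⟩
    simp only at hps hne ⊢
    -- `2 * p + s ≤ p + k ≤ 2 * k`, with equality throughout only for `(p, s) = (k, 0)`.
    rw [stratumDim_eq (by omega), stratumDim_eq (by omega)]
    omega
  · rintro X ⟨⟨hr, hX⟩, htan⟩
    obtain ⟨p, s, hps, hmem⟩ := exists_mem_stratum hX hr hk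
    refine mem_iUnion.2 ⟨⟨(⟨p, by omega⟩, ⟨s, by omega⟩), hps, ?_⟩, hmem⟩
    rintro ⟨hp, hs⟩
    simp only at hp hs
    subst hp hs
    exact htan (isNonTangential_of_mem_stratum hk hmem)

theorem isThinIn_empty {E : Type*} [NormedAddCommGroup E] [NormedSpace ℝ E] {M : Set E} {d : ℕ}
    (hM : HasManifoldDim d M) : IsThinIn ∅ M :=
  ⟨d, hM, 0, Fin.elim0, Fin.elim0, fun i => i.elim0, empty_subset _⟩

end Thinness

theorem theorem8 (N k : ℕ) (hkN : k ≤ N) :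
    IsThinIn (tangentialPoints N k) (hankelRankLE N k) ∧
    IsThinIn {A | A ∈ genericHankel N k ∧ ¬ IsNonTangential (rankLE N k) (hankelMatrices N) A}
      (genericHankel N k) := by
  constructor
  · rcases hkN.lt_or_eq with hlt | rfl
    · exact isThinIn_tangentialPoints hlt
    · have h1 : tangentialPoints k k = ∅ := eq_empty_of_forall_notMem fun A hA => hA.2 (by
        rw [rankLE_self]
        exact isNonTangential_univ (hankelSubmodule k) hA.1.2)
      rw [h1, hankelRankLE, rankLE_self, univ_inter]
      exact isThinIn_empty fun A hA =>
        subset_closure (isManifoldAt_submodule (hankelSubmodule k) hA)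
  · have h1 : {A | A ∈ genericHankel N k ∧
        ¬ IsNonTangential (rankLE N k) (hankelMatrices N) A} = ∅ :=
      eq_empty_of_forall_notMem fun A hA => hA.2 (isNonTangential_of_mem_genericHankel hkN hA.1)
    rw [h1]
    exact isThinIn_empty fun A hA => subset_closure (isManifoldAt_genericHankel hkN hA)
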